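/- Trees are finite, rooted at $r$, with positive edge lengths, $d_u$ being the length of the edge from $u\neq r$ to its parent $p(u)$, and simple: no vertex other than possibly $r$ has degree $2$. Leaves are the vertices without children. Fix an integer $k\ge 2$. A discrete (resp. fractional) configuration on $T$ assigns to each leaf $\ell$ a number $x_\ell\in\mathbb N$ (resp. $y_\ell\in\mathbb R_{\ge 0}$) with total $k$; it is extended to all vertices by $x_u=\sum_{\ell\preceq u}x_\ell$, the sum over the leaves that descend from $u$. Let $\mathcal X(T)$ and $\mathcal Y(T)$ be the sets of discrete and fractional configurations, $\mathrm{OT}_T(x,x')=\sum_{u\ne r}d_u|x_u-x'_u|$, and $$\Psi(T,x)=\sum_{u\neq r}d_u\,\phi(x_u),\qquad \phi(z)=az+bz^2,\quad a=20k,\ b=5 .$$ The continuous tree-mining game. The state at time $t$ is a tree $T(t)$, a configuration $x(t)\in\mathcal X(T(t))$ and the player's accumulated cost $\mathrm{Cost}(t)$. At time $0$ the tree is a single vertex or a single edge, all robots are at its only leaf, and the cost is $0$. The adversary can - elongate: at each instant between discrete events it selects (measurably in time) a leaf $\ell(t)\ne r$ with $x_{\ell(t)}(t)\ge 2$, and $d_{\ell(t)}$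 grows at unit rate, the player paying at rate $x_{\ell(t)}(t)$; - fork: give $m\in\{2,\dots,x_\ell-1\}$ new children to a leaf $\ell$ with $x_\ell\ge 3$, at a common distance $\delta\in(0,1)$ from $\ell$ chosen by the player; - kill a leaf $\ell$ that is not the only leaf; if $p(\ell)\neq r$ and $p(\ell)$ is left with a single child, $p(\ell)$ is suppressed and its two edges are merged into one, their lengths being added. The player's strategy. As soon as some $x'\ne x$ in $\mathcal X(T)$ satisfies $\Psi(T,x)-\Psi(T,x')\ge \mathrm{OT}_T(x,x')$, the player moves to some $x'\neq x$ that minimizes $\Psi(T,x')+\mathrm{OT}_T(x,x')$ over $\mathcal X(T)$, and pays $\mathrm{OT}_T(x,x')$; the adversary acts only when no such move is left. When a leaf is killed or forked, turning $T$ into $T'$, the player moves to a minimizer $x'$ over $\mathcal X(T')$ of $\Psi(T',x')+\mathrm{OT}(x,x')$ and pays $\mathrm{OT}(x,x')$, where $\mathrm{OT}$ is taken in $T$ for a kill (with $x'_\ell=0$ at the killed leaf) and in $T'$ for a fork (the robots of $x$ at the forked leaf $\ell$ sitting at the vertex $\ell$ of $T'$). Ties between minimizers are broken arbitrarily. Claim.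 If the fork lengths are chosen small enough, that is, if each fork length is positive and at most a suitable threshold $\delta_0\in(0,1)$ that depends only on $k$, on the current state $(T,x)$, on the forked leaf and on the number $m$ of children, then whatever the adversary does, and however ties are broken, at all times $t$ (through elongations, forks and deletions) the function $\Psi(T(t),\cdot)$ has a unique minimizer $y(t)$ over $\mathcal Y(T(t))$, and $$\mathrm{Cost}(t)+\Psi(T(t),x(t))\le 48\,\Psi(T(t),y(t)).$$ -/

import Mathlib

open MeasureTheory

noncomputable section

/-- A finite simple weighted rooted tree with vertices named by natural numbers, given by its parent
function: every vertex leads to the root by iterating `parent`, so the tree is connected and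
acyclic. `d u` is the length of the edge from `u` to `parent u`. A non-root vertex has degree
`2` exactly when it has one child, so `simple` says that no vertex has degree `2`, except possibly
the root. The values of `parent` and `d` outside `V` (and of `d` at the root) are irrelevant. -/
structure WTree where
  V : Finset ℕ
  root : ℕ
  parent : ℕ → ℕ
  d : ℕ → ℝ
  root_mem : root ∈ V
  parent_root : parent root = root
  parent_mem : ∀ u ∈ V, parent u ∈ V
  reaches_root : ∀ u ∈ V, ∃ n : ℕ, parent^[n] u = root
  d_pos : ∀ u ∈ V, u ≠ root → 0 < d u
  simple : ∀ v ∈ V, v ≠ root → (V.filter fun w => w ≠ root ∧ parent w = v).card ≠ 1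

namespace WTree

/-- The children of `v`. -/
def children (T : WTree) (v : ℕ) : Finset ℕ :=
  T.V.filter fun w => w ≠ T.root ∧ T.parent w = v

/-- The leaves: the vertices without children. The root is a leaf only if it is the only vertex. -/
def leaves (T : WTree) : Finset ℕ :=
  T.V.filter fun v => T.children v = ∅

/-- `T.Desc u v`: `u` is a descendant of `v` (possibly `u = v`). -/
def Desc (T : WTree) (u v : ℕ) : Prop :=
  ∃ n : ℕ, T.parent^[n] u = v

/-- The extension of a configuration to all vertices: `T.mass z u` is the total weight that `z` puts
on the descendants of `u`. If `z` lives on the leaves this is `∑_{ℓ ≼ u} z_ℓ`. Summing over all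
vertices makes sense also of the weight sitting at a former leaf that has just been forked. -/
def mass (T : WTree) (z : ℕ → ℝ) (u : ℕ) : ℝ :=
  open scoped Classical in
  ∑ v ∈ T.V.filter (fun v => T.Desc v u), z v

/-- The optimal transport cost `∑_u d_u |z_u - z'_u|`. -/
def OT (T : WTree) (z z' : ℕ → ℝ) : ℝ :=
  ∑ u ∈ T.V.erase T.root, T.d u * |T.mass z u - T.mass z' u|

/-- The potential `∑_{u ≠ root} d_u φ(z_u)`. -/
def Psi (φ : ℝ → ℝ) (T : WTree) (z : ℕ → ℝ) : ℝ :=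
  ∑ u ∈ T.V.erase T.root, T.d u * φ (T.mass z u)

end WTree

/-- A discrete configuration, seen as a fractional one. -/
abbrev toFrac (x : ℕ → ℕ) : ℕ → ℝ := fun v => (x v : ℝ)

/-- The discrete configurations of `k` robots on `T`, extended by `0` off the leaves. -/
def discreteConfigs (k : ℕ) (T : WTree) : Set (ℕ → ℕ) :=
  {x | (∀ v, v ∉ T.leaves → x v = 0) ∧ ∑ ℓ ∈ T.leaves, x ℓ = k}

/-- The fractional configurations of total weight `k` on `T`, extended by `0` off the leaves. -/
def fracConfigs (k : ℕ) (T : WTree) : Set (ℕ → ℝ) :=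
  {y | (∀ v, v ∉ T.leaves → y v = 0) ∧ (∀ ℓ ∈ T.leaves, 0 ≤ y ℓ) ∧ ∑ ℓ ∈ T.leaves, y ℓ = k}

/-- `y` is an optimal fractional configuration of `T`. -/
def IsOptimalFrac (φ : ℝ → ℝ) (k : ℕ) (T : WTree) (y : ℕ → ℝ) : Prop :=
  y ∈ fracConfigs k T ∧ IsMinOn (T.Psi φ) (fracConfigs k T) y

/-- The player has no reason to move: `Ψ(x) - Ψ(x') < OT(x, x')` for all configurations `x' ≠ x`. -/
def Stable (φ : ℝ → ℝ) (k : ℕ) (T : WTree) (x : ℕ → ℕ) : Prop :=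
  ∀ x' ∈ discreteConfigs k T, x' ≠ x →
    T.Psi φ (toFrac x) - T.Psi φ (toFrac x') < T.OT (toFrac x) (toFrac x')

/-- `x'` is a response of the player's strategy: it minimizes `Ψ(T', ·) + OT_S(x, ·)` over the
discrete configurations of `T'`, where `S` is the tree along which the robots travel. -/
def IsResponse (φ : ℝ → ℝ) (k : ℕ) (S : WTree) (x : ℕ → ℕ) (T' : WTree) (x' : ℕ → ℕ) : Prop :=
  x' ∈ discreteConfigs k T' ∧
    IsMinOn (fun z => T'.Psi φ (toFrac z) + S.OT (toFrac x) (toFrac z)) (discreteConfigs k T') x'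

/-- The tree in which the edge above `u` has grown by `g u`. -/
def WTree.elongate (T : WTree) (g : ℕ → NNReal) : WTree :=
  { T with
    d := fun u => T.d u + g u
    d_pos := fun u hu hr => add_pos_of_pos_of_nonneg (T.d_pos u hu hr) (g u).2 }

/-- If at each instant `σ` the edge above the leaf `lf σ` grows at unit rate, then
`grown lf τ u` is the amount by which the edge above `u` has grown during `[0, τ)`. -/
def grown (lf : ℝ → ℕ) (τ : ℝ) (u : ℕ) : NNReal :=
  (volume {σ : ℝ | 0 ≤ σ ∧ σ < τ ∧ lf σ = u}).toNNReal

/-- `T'` is obtained from `T` by endowing the leaf `ℓ` with the set `C` of new children, all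
at distance `len`. -/
def IsFork (T : WTree) (ℓ : ℕ) (C : Finset ℕ) (len : ℝ) (T' : WTree) : Prop :=
  ℓ ∈ T.leaves ∧ Disjoint T.V C ∧ T'.V = T.V ∪ C ∧ T'.root = T.root ∧
  (∀ u ∈ T.V, u ≠ T.root → T'.parent u = T.parent u ∧ T'.d u = T.d u) ∧
  (∀ c ∈ C, T'.parent c = ℓ ∧ T'.d c = len)

/-- `T'` is obtained from `T` by killing the leaf `ℓ`, which is not the only one. If `parent ℓ`
is not the root and has exactly one child `u` besides `ℓ`, then `parent ℓ` is suppressed and the two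
edges that meet there are merged; otherwise only `ℓ` and its edge disappear. -/
def IsKill (T : WTree) (ℓ : ℕ) (T' : WTree) : Prop :=
  ℓ ∈ T.leaves ∧ (∃ ℓ' ∈ T.leaves, ℓ' ≠ ℓ) ∧ T'.root = T.root ∧
  (((T.parent ℓ = T.root ∨ ((T.children (T.parent ℓ)).erase ℓ).card ≠ 1) ∧
      T'.V = T.V.erase ℓ ∧
      ∀ v ∈ T'.V, v ≠ T.root → T'.parent v = T.parent v ∧ T'.d v = T.d v) ∨
    (T.parent ℓ ≠ T.root ∧ ∃ u, (T.children (T.parent ℓ)).erase ℓ = {u} ∧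
      T'.V = (T.V.erase ℓ).erase (T.parent ℓ) ∧
      T'.parent u = T.parent (T.parent ℓ) ∧ T'.d u = T.d (T.parent ℓ) + T.d u ∧
      ∀ v ∈ T'.V, v ≠ T.root → v ≠ u → T'.parent v = T.parent v ∧ T'.d v = T.d v))

/-- `Play φ k δ t T x c`: there is a play of the continuous tree-mining game with `k` robots in which
the player follows the strategy of potential `φ` and of fork lengths `δ T x ℓ m`, and which at time
`t` is in the state `(T, x)` with accumulated cost `c`. Several discrete events may occur, one after
the other, at the same time. The adversary can act only once the player has reached a stable
configuration; ties between responses are broken arbitrarily, but never in favor of not moving. -/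
inductive Play (φ : ℝ → ℝ) (k : ℕ) (δ : WTree → (ℕ → ℕ) → ℕ → ℕ → ℝ) :
    ℝ → WTree → (ℕ → ℕ) → ℝ → Prop
  /-- Initially the tree is a single vertex, or a single edge of any length, and all robots are at
  its only leaf. -/
  | init (T : WTree) (x : ℕ → ℕ) (hT : T.V.card ≤ 2) (hx : x ∈ discreteConfigs k T) :
      Play φ k δ 0 T x 0
  /-- During a time `s`, the adversary elongates at each instant a leaf hosting at least two robots,
  while the player stays in the configuration `x`. -/
  | elongate {t : ℝ} {T : WTree} {x : ℕ → ℕ} {c : ℝ} (h : Play φ k δ t T x c)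
      (s : ℝ) (hs : 0 ≤ s) (lf : ℝ → ℕ) (hmeas : Measurable lf)
      (hlf : ∀ σ, 0 ≤ σ → σ < s → lf σ ∈ T.leaves ∧ lf σ ≠ T.root ∧ 2 ≤ x (lf σ))
      (hstable : ∀ τ, 0 ≤ τ → τ < s → Stable φ k (T.elongate (grown lf τ)) x) :
      Play φ k δ (t + s) (T.elongate (grown lf s)) x (c + ∫ σ in (0 : ℝ)..s, (x (lf σ) : ℝ))
  /-- The player moves to another configuration. -/
  | move {t : ℝ} {T : WTree} {x : ℕ → ℕ} {c : ℝ} (h : Play φ k δ t T x c)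
      (x' : ℕ → ℕ) (hne : x' ≠ x) (hresp : IsResponse φ k T x T x') :
      Play φ k δ t T x' (c + T.OT (toFrac x) (toFrac x'))
  /-- The adversary forks a leaf, and the player reassigns its robots in the new tree. -/
  | fork {t : ℝ} {T : WTree} {x : ℕ → ℕ} {c : ℝ} (h : Play φ k δ t T x c)
      (hstable : Stable φ k T x) (ℓ m : ℕ) (hm : 2 ≤ m) (hmx : m + 1 ≤ x ℓ)
      (C : Finset ℕ) (hC : C.card = m) (T' : WTree) (hT' : IsFork T ℓ C (δ T x ℓ m) T')
      (x' : ℕ → ℕ) (hresp : IsResponse φ k T' x T' x') :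
      Play φ k δ t T' x' (c + T'.OT (toFrac x) (toFrac x'))
  /-- The adversary kills a leaf, and the player moves in the old tree to the remaining leaves. -/
  | kill {t : ℝ} {T : WTree} {x : ℕ → ℕ} {c : ℝ} (h : Play φ k δ t T x c)
      (hstable : Stable φ k T x) (ℓ : ℕ) (T' : WTree) (hT' : IsKill T ℓ T')
      (x' : ℕ → ℕ) (hresp : IsResponse φ k T x T' x') :
      Play φ k δ t T' x' (c + T.OT (toFrac x) (toFrac x'))

end

open MeasureTheory

noncomputable section

/-! ### Rooted trees: descendants, masses, and the path between two leaves -/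

namespace WTree

variable {T : WTree}

/-! The potential is a convex quadratic function of the masses with positive weight on every edge,
so its fractional minimizer `y` exists and is unique (`exists_isOptimalFrac`, `IsOptimalFrac.eq`).
By induction on the play (`Play.invariant`), the bound `Cost + Ψ(x) ≤ 48 Ψ(y)` is carried along with
a second invariant: `y` puts at least `1 / 2` on every leaf.

The main tool is the marginal potential `WTree.price` of a leaf. Under `y`, a loaded leaf is never
more expensive than another leaf; under a stable `x`, an occupied leaf is more expensive than
another by at most `6` times the length of the path between them (`WeaklyStable.price_sub_le`). If
`x` exceeded `y` by too much at a leaf, there would be a path from it to another leaf along which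
the masses of `x` are too large on one side and too small on the other (`WTree.exists_exchange`),
against these two facts. Hence `x ℓ ≤ 6 / 5 + (1 + 3 / (10 k)) y ℓ` (`WeaklyStable.le_add`). The
same exchange between two fractional configurations (`le_of_price_le`) shows that no event lowers
`y` at the leaves it does not touch.

Each event is then paid for by the growth of `Ψ(y)`. Under elongation, `φ(y ℓ)` dominates `x ℓ + φ(x
ℓ)` up to a constant, because `y ℓ` is at least a fixed fraction of `x ℓ ≥ 2`. At a fork, short
edges lower the optimal weight below `ℓ` by at most `1 / 2`, and its equal division among the
children still leaves `1 / 2` each. At a deletion, strong convexity raises `Ψ(y)` by at least `5 d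
y²` at the killed leaf. This pays for moving its robots to a leaf below its parent; that leaf is not
far, since `y` loads every leaf. -/

lemma Desc.refl (T : WTree) (u : ℕ) : T.Desc u u := ⟨0, rfl⟩

lemma Desc.trans {u v w : ℕ} (h : T.Desc u v) (h' : T.Desc v w) : T.Desc u w := by
  obtain ⟨n, rfl⟩ := h
  obtain ⟨m, rfl⟩ := h'
  exact ⟨m + n, Function.iterate_add_apply _ _ _ _⟩

lemma Desc.parent (T : WTree) (u : ℕ) : T.Desc u (T.parent u) := ⟨1, rfl⟩

lemma iterate_parent_root (T : WTree) (n : ℕ) : T.parent^[n] T.root = T.root :=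
  Function.iterate_fixed T.parent_root n

lemma iterate_parent_mem {u : ℕ} (hu : u ∈ T.V) (n : ℕ) : T.parent^[n] u ∈ T.V := by
  induction n with
  | zero => exact hu
  | succ n ih => rw [Function.iterate_succ_apply']; exact T.parent_mem _ ih

lemma Desc.mem {u v : ℕ} (h : T.Desc u v) (hu : u ∈ T.V) : v ∈ T.V := by
  obtain ⟨n, rfl⟩ := h
  exact iterate_parent_mem hu n

lemma desc_root {u : ℕ} (hu : u ∈ T.V) : T.Desc u T.root := T.reaches_root u hu

/-- Two ancestors of a vertex are comparable. -/
lemma Desc.total {u v w : ℕ} (hv : T.Desc u v) (hw : T.Desc u w) : T.Desc v w ∨ T.Desc w v := by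
  obtain ⟨n, rfl⟩ := hv
  obtain ⟨m, rfl⟩ := hw
  rcases le_total n m with h | h
  · left
    refine ⟨m - n, ?_⟩
    rw [← Function.iterate_add_apply, Nat.sub_add_cancel h]
  · right
    refine ⟨n - m, ?_⟩
    rw [← Function.iterate_add_apply, Nat.sub_add_cancel h]

lemma Desc.eq_or_parent {u v : ℕ} (h : T.Desc u v) : v = u ∨ T.Desc (T.parent u) v := by
  obtain ⟨n, rfl⟩ := h
  cases n with
  | zero => exact Or.inl rfl
  | succ n => exact Or.inr ⟨n, rfl⟩

/-- A vertex that is fixed by a positive iterate of `parent` is the root. -/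
lemma eq_root_of_iterate_eq {u : ℕ} (hu : u ∈ T.V) {n : ℕ} (hn : n ≠ 0)
    (h : T.parent^[n] u = u) : u = T.root := by
  obtain ⟨N, hN⟩ := T.reaches_root u hu
  -- After `n * N` steps the walk is back at `u`, yet after `N ≤ n * N` steps it has been absorbed
  -- by the root.
  have h1 : T.parent^[n * N] u = u := by
    rw [Function.iterate_mul]
    exact Function.iterate_fixed h N
  have h2 : N ≤ n * N := Nat.le_mul_of_pos_left _ (Nat.pos_of_ne_zero hn)
  rw [← Nat.sub_add_cancel h2, Function.iterate_add_apply, hN, iterate_parent_root] at h1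
  exact h1.symm

lemma Desc.antisymm {u v : ℕ} (hu : u ∈ T.V) (h : T.Desc u v) (h' : T.Desc v u) : u = v := by
  obtain ⟨n, rfl⟩ := h
  obtain ⟨m, hm⟩ := h'
  by_cases hnm : m + n = 0
  · obtain ⟨rfl, rfl⟩ : m = 0 ∧ n = 0 := by omega
    rfl
  · rw [← Function.iterate_add_apply] at hm
    have := eq_root_of_iterate_eq hu hnm hm
    subst this
    exact (iterate_parent_root T n).symm

lemma parent_ne {u : ℕ} (hu : u ∈ T.V) (hr : u ≠ T.root) : T.parent u ≠ u :=
  fun h => hr (eq_root_of_iterate_eq (n := 1) hu one_ne_zero h)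

lemma mem_children {v w : ℕ} : w ∈ T.children v ↔ w ∈ T.V ∧ w ≠ T.root ∧ T.parent w = v := by
  simp [children]

lemma mem_leaves {v : ℕ} : v ∈ T.leaves ↔ v ∈ T.V ∧ T.children v = ∅ := by
  simp [leaves]

lemma mem_V_of_mem_leaves {v : ℕ} (h : v ∈ T.leaves) : v ∈ T.V := (mem_leaves.1 h).1

lemma parent_ne_leaf {v w : ℕ} (hv : v ∈ T.leaves) (hw : w ∈ T.V) (hr : w ≠ T.root) :
    T.parent w ≠ v := by
  intro h
  have : w ∈ T.children v := mem_children.2 ⟨hw, hr, h⟩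
  rw [(mem_leaves.1 hv).2] at this
  simp at this

lemma exists_child_of_desc {u v : ℕ} (hu : u ∈ T.V) (h : T.Desc u v) (hne : u ≠ v) :
    ∃ c ∈ T.children v, T.Desc u c := by
  classical
  have hn : T.parent^[Nat.find h] u = v := Nat.find_spec h
  have hmin : ∀ m < Nat.find h, T.parent^[m] u ≠ v := fun m hm => Nat.find_min h hm
  generalize Nat.find h = n at hn hmin
  cases n with
  | zero => exact absurd hn hne
  | succ n =>
    refine ⟨T.parent^[n] u, mem_children.2 ⟨iterate_parent_mem hu n, ?_, ?_⟩, ⟨n, rfl⟩⟩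
    · intro hr
      apply hmin n (Nat.lt_succ_self n)
      rw [Function.iterate_succ_apply', hr, T.parent_root] at hn
      rw [hr, hn]
    · rwa [Function.iterate_succ_apply'] at hn

lemma eq_of_desc_leaf {u ℓ : ℕ} (hu : u ∈ T.V) (hℓ : ℓ ∈ T.leaves) (h : T.Desc u ℓ) : u = ℓ := by
  by_contra hne
  obtain ⟨c, hc, -⟩ := exists_child_of_desc hu h hne
  rw [(mem_leaves.1 hℓ).2] at hc
  simp at hc

lemma not_desc_child {v c : ℕ} (hc : c ∈ T.children v) : ¬ T.Desc v c := by
  intro h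
  obtain ⟨hcV, hcr, rfl⟩ := mem_children.1 hc
  exact parent_ne hcV hcr (Desc.antisymm hcV (Desc.parent T c) h).symm

lemma desc_of_mem_children {v c : ℕ} (hc : c ∈ T.children v) : T.Desc c v := by
  obtain ⟨-, -, rfl⟩ := mem_children.1 hc
  exact Desc.parent T c

/-- Distinct children of a vertex have no common descendant. -/
lemma not_desc_of_ne_children {v c c' w : ℕ} (hc : c ∈ T.children v) (hc' : c' ∈ T.children v)
    (hne : c ≠ c') (h : T.Desc w c) : ¬ T.Desc w c' := by
  intro h'
  rcases Desc.total h h' with h1 | h1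
  · rcases h1.eq_or_parent with h2 | h2
    · exact hne h2.symm
    · rw [(mem_children.1 hc).2.2] at h2
      exact not_desc_child hc' h2
  · rcases h1.eq_or_parent with h2 | h2
    · exact hne h2
    · rw [(mem_children.1 hc').2.2] at h2
      exact not_desc_child hc h2

open scoped Classical in
/-- The set of descendants of `v`. -/
def descendants (T : WTree) (v : ℕ) : Finset ℕ := T.V.filter fun w => T.Desc w v

lemma mem_descendants {v w : ℕ} : w ∈ T.descendants v ↔ w ∈ T.V ∧ T.Desc w v := by
  simp [descendants]

lemma mass_eq (T : WTree) (z : ℕ → ℝ) (u : ℕ) : T.mass z u = ∑ v ∈ T.descendants u, z v := rfl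

lemma descendants_eq {v : ℕ} (hv : v ∈ T.V) :
    T.descendants v = insert v ((T.children v).biUnion T.descendants) := by
  ext w
  simp only [mem_descendants, Finset.mem_insert, Finset.mem_biUnion]
  constructor
  · rintro ⟨hw, h⟩
    by_cases hne : w = v
    · exact Or.inl hne
    · obtain ⟨c, hc, h'⟩ := exists_child_of_desc hw h hne
      exact Or.inr ⟨c, hc, hw, h'⟩
  · rintro (rfl | ⟨c, hc, hw, h⟩)
    · exact ⟨hv, Desc.refl T w⟩
    · exact ⟨hw, h.trans (desc_of_mem_children hc)⟩

lemma mass_eq_add_sum_children (z : ℕ → ℝ) {v : ℕ} (hv : v ∈ T.V) :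
    T.mass z v = z v + ∑ c ∈ T.children v, T.mass z c := by
  rw [mass_eq, descendants_eq hv, Finset.sum_insert, Finset.sum_biUnion]
  · rfl
  · intro c hc c' hc' hne
    rw [Function.onFun, Finset.disjoint_left]
    intro w hw hw'
    exact not_desc_of_ne_children hc hc' hne (mem_descendants.1 hw).2 (mem_descendants.1 hw').2
  · simp only [Finset.mem_biUnion, mem_descendants, not_exists, not_and]
    exact fun c hc _ h => not_desc_child hc h

lemma descendants_child_ssubset {v c : ℕ} (hv : v ∈ T.V) (hc : c ∈ T.children v) :
    T.descendants c ⊂ T.descendants v := by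
  rw [Finset.ssubset_iff_of_subset]
  · exact ⟨v, mem_descendants.2 ⟨hv, Desc.refl T v⟩,
      fun h => not_desc_child hc (mem_descendants.1 h).2⟩
  · intro w hw
    obtain ⟨h1, h2⟩ := mem_descendants.1 hw
    exact mem_descendants.2 ⟨h1, h2.trans (desc_of_mem_children hc)⟩

/-- A property that passes from every inner vertex to one of its children holds along a path down to
some leaf. -/
lemma exists_leaf_path (Q : ℕ → Prop)
    (hQ : ∀ v ∈ T.V, v ∉ T.leaves → Q v → ∃ c ∈ T.children v, Q c) (v : ℕ) (hv : v ∈ T.V)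
    (hv' : Q v) : ∃ ℓ ∈ T.leaves, T.Desc ℓ v ∧ ∀ u, T.Desc ℓ u → T.Desc u v → Q u := by
  induction hs : (T.descendants v).card using Nat.strong_induction_on generalizing v with
  | _ n ih =>
    subst hs
    by_cases hl : v ∈ T.leaves
    · refine ⟨v, hl, Desc.refl T v, fun u h1 h2 => ?_⟩
      rwa [← Desc.antisymm hv h1 h2]
    · obtain ⟨c, hc, hQc⟩ := hQ v hv hl hv'
      have hcV := (mem_children.1 hc).1
      obtain ⟨ℓ, hℓ, h1, h2⟩ := ih _ (Finset.card_lt_card (descendants_child_ssubset hv hc)) c hcV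
        hQc rfl
      refine ⟨ℓ, hℓ, h1.trans (desc_of_mem_children hc), fun u h3 h4 => ?_⟩
      rcases Desc.total h1 h3 with h5 | h5
      · rcases h5.eq_or_parent with rfl | h6
        · exact hQc
        · rw [(mem_children.1 hc).2.2] at h6
          rwa [← Desc.antisymm hv h6 h4]
      · exact h2 u h3 h5

lemma exists_child_of_not_leaf {v : ℕ} (hv : v ∈ T.V) (hl : v ∉ T.leaves) :
    (T.children v).Nonempty := by
  rw [Finset.nonempty_iff_ne_empty]
  exact fun h => hl (mem_leaves.2 ⟨hv, h⟩)

lemma exists_leaf_desc {v : ℕ} (hv : v ∈ T.V) : ∃ ℓ ∈ T.leaves, T.Desc ℓ v := by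
  obtain ⟨ℓ, h1, h2, -⟩ := exists_leaf_path (T := T) (fun _ => True)
    (fun v hv hl _ => (exists_child_of_not_leaf hv hl).imp fun c hc => ⟨hc, trivial⟩) v hv trivial
  exact ⟨ℓ, h1, h2⟩

open scoped Classical in
/-- The vertices on the path from `v` to the root, without the root. -/
def anc (T : WTree) (v : ℕ) : Finset ℕ := (T.V.erase T.root).filter fun u => T.Desc v u

lemma mem_anc {v u : ℕ} : u ∈ T.anc v ↔ u ≠ T.root ∧ u ∈ T.V ∧ T.Desc v u := by
  simp [anc, and_assoc]

/-- If the leaf `ℓ` carries more than `θ` and the whole tree at most `θ`, then weight could be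
exchanged with another leaf `ℓ'`: the masses exceed `θ` on the way up from `ℓ`, and are negative on
the way down to `ℓ'`. -/
lemma exists_exchange (z : ℕ → ℝ) (hz : ∀ v, v ∉ T.leaves → z v = 0) (θ : ℝ) {ℓ : ℕ}
    (hℓ : ℓ ∈ T.V) (h1 : θ < T.mass z ℓ) (h2 : T.mass z T.root ≤ θ) :
    ∃ ℓ' ∈ T.leaves, T.mass z ℓ' < 0 ∧ (∀ u ∈ T.anc ℓ \ T.anc ℓ', θ < T.mass z u) ∧
      ∀ u ∈ T.anc ℓ' \ T.anc ℓ, T.mass z u < 0 := by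
  classical
  -- Climb to the vertex `v` just below the first ancestor of mass at most `θ`. That ancestor has no
  -- weight of its own, so `v` has a sibling of negative mass, and from there a negative child
  -- exists at every level down to a leaf.
  have hex : ∃ n, T.mass z (T.parent^[n] ℓ) ≤ θ := by
    obtain ⟨n, hn⟩ := T.reaches_root ℓ hℓ
    exact ⟨n, by rwa [hn]⟩
  have hn := Nat.find_spec hex
  have hmin : ∀ m < Nat.find hex, θ < T.mass z (T.parent^[m] ℓ) :=
    fun m hm => not_le.1 (Nat.find_min hex hm)
  generalize Nat.find hex = n at hn hmin
  cases n with
  | zero => exact absurd hn (not_le.2 h1)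
  | succ n =>
    have hv := hmin n (Nat.lt_succ_self n)
    set v := T.parent^[n] ℓ with hvdef
    rw [Function.iterate_succ_apply', ← hvdef] at hn
    have hvV : v ∈ T.V := iterate_parent_mem hℓ n
    have hvr : v ≠ T.root := by
      intro h
      rw [h] at hv
      linarith
    have hvc : v ∈ T.children (T.parent v) := mem_children.2 ⟨hvV, hvr, rfl⟩
    have hwV := T.parent_mem v hvV
    have hwl : ∀ {w c}, c ∈ T.children w → z w = 0 := by
      intro w c hc
      apply hz
      intro hl
      rw [(mem_leaves.1 hl).2] at hc
      simp at hc
    rw [mass_eq_add_sum_children z hwV, hwl hvc, zero_add, ← Finset.add_sum_erase _ _ hvc] at hn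
    obtain ⟨c, hc, hc0⟩ : ∃ c ∈ (T.children (T.parent v)).erase v, T.mass z c < 0 := by
      by_contra! hcon
      have := Finset.sum_nonneg hcon
      linarith
    obtain ⟨hcv, hc⟩ := Finset.mem_erase.1 hc
    have hcV := (mem_children.1 hc).1
    obtain ⟨ℓ', hℓ', h3, h4⟩ := exists_leaf_path (T := T) (fun u => T.mass z u < 0) (by
      intro u hu hul hu0
      obtain ⟨c, hc⟩ := exists_child_of_not_leaf hu hul
      by_contra! hcon
      rw [mass_eq_add_sum_children z hu, hwl hc, zero_add] at hu0
      have := Finset.sum_nonneg hcon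
      linarith) c hcV hc0
    refine ⟨ℓ', hℓ', h4 ℓ' (Desc.refl T ℓ') h3, ?_, ?_⟩
    · intro u hu
      rw [Finset.mem_sdiff, mem_anc, mem_anc] at hu
      obtain ⟨⟨hur, huV, m, rfl⟩, hu'⟩ := hu
      apply hmin
      by_contra! hm
      apply hu'
      refine ⟨hur, huV, h3.trans ((desc_of_mem_children hc).trans ⟨m - (n + 1), ?_⟩)⟩
      rw [hvdef, ← Function.iterate_succ_apply' T.parent n ℓ, ← Function.iterate_add_apply,
        Nat.sub_add_cancel hm]
    · intro u hu
      rw [Finset.mem_sdiff, mem_anc, mem_anc] at hu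
      obtain ⟨⟨hur, huV, hu1⟩, hu'⟩ := hu
      apply h4 u hu1
      rcases Desc.total h3 hu1 with h5 | h5
      · rcases h5.eq_or_parent with rfl | h6
        · exact Desc.refl T u
        · exfalso
          rw [(mem_children.1 hc).2.2] at h6
          exact hu' ⟨hur, huV, Desc.trans ⟨n + 1, by
            rw [Function.iterate_succ_apply']⟩ h6⟩
      · exact h5

end WTree

/-! ### The quadratic potential and its marginal prices -/

/-- The function `φ(z) = 20kz + 5z²` of the potential. -/
def pot (k : ℕ) (z : ℝ) : ℝ := 20 * k * z + 5 * z ^ 2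

lemma pot_zero (k : ℕ) : pot k 0 = 0 := by simp [pot]

lemma pot_nonneg (k : ℕ) {z : ℝ} (hz : 0 ≤ z) : 0 ≤ pot k z := by
  unfold pot; positivity

lemma pot_le_pot (k : ℕ) {z w : ℝ} (hz : 0 ≤ z) (h : z ≤ w) : pot k z ≤ pot k w := by
  unfold pot; gcongr

lemma linear_le_pot (k : ℕ) (z : ℝ) : 20 * k * z ≤ pot k z := by
  unfold pot; nlinarith [sq_nonneg z]

lemma pot_le_linear (k : ℕ) {z : ℝ} (hz : 0 ≤ z) (h : z ≤ k) : pot k z ≤ 25 * k * z := by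
  unfold pot; nlinarith [mul_le_mul_of_nonneg_right h hz]

/-- The weight `z` after the transfer of the amount `t` from `ℓ` to `ℓ'`. -/
def shift (z : ℕ → ℝ) (ℓ ℓ' : ℕ) (t : ℝ) (v : ℕ) : ℝ :=
  z v + t * ((if v = ℓ' then 1 else 0) - (if v = ℓ then 1 else 0))

namespace WTree

variable {T : WTree}

lemma mass_lincomb (T : WTree) (s t : ℝ) (z w : ℕ → ℝ) (u : ℕ) :
    T.mass (fun v => s * z v + t * w v) u = s * T.mass z u + t * T.mass w u := by
  simp only [mass_eq, Finset.sum_add_distrib, Finset.mul_sum]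

lemma mass_sub (T : WTree) (z w : ℕ → ℝ) (u : ℕ) :
    T.mass (fun v => z v - w v) u = T.mass z u - T.mass w u := by
  simp only [mass_eq, Finset.sum_sub_distrib]

lemma mass_nonneg {z : ℕ → ℝ} (hz : ∀ v, 0 ≤ z v) (u : ℕ) : 0 ≤ T.mass z u :=
  Finset.sum_nonneg fun v _ => hz v

lemma mass_leaf (z : ℕ → ℝ) {ℓ : ℕ} (hℓ : ℓ ∈ T.leaves) : T.mass z ℓ = z ℓ := by
  rw [mass_eq_add_sum_children z (mem_V_of_mem_leaves hℓ), (mem_leaves.1 hℓ).2]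
  simp

lemma mass_root {z : ℕ → ℝ} (hz : ∀ v, v ∉ T.leaves → z v = 0) :
    T.mass z T.root = ∑ ℓ ∈ T.leaves, z ℓ := by
  rw [mass_eq]
  symm
  apply Finset.sum_subset
  · intro v hv
    have := mem_V_of_mem_leaves hv
    exact mem_descendants.2 ⟨this, desc_root this⟩
  · exact fun v _ hv => hz v hv

lemma mass_le_mass {z : ℕ → ℝ} (hz : ∀ v, 0 ≤ z v) {u v : ℕ} (h : T.Desc u v) :
    T.mass z u ≤ T.mass z v := by
  apply Finset.sum_le_sum_of_subset_of_nonneg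
  · intro w hw
    obtain ⟨h1, h2⟩ := mem_descendants.1 hw
    exact mem_descendants.2 ⟨h1, h2.trans h⟩
  · exact fun v _ _ => hz v

open scoped Classical in
lemma mass_shift (z : ℕ → ℝ) {ℓ ℓ' : ℕ} (hℓ : ℓ ∈ T.V) (hℓ' : ℓ' ∈ T.V) (t : ℝ) (u : ℕ) :
    T.mass (shift z ℓ ℓ' t) u =
      T.mass z u + t * ((if T.Desc ℓ' u then 1 else 0) - (if T.Desc ℓ u then 1 else 0)) := by
  simp only [mass_eq, shift, Finset.sum_add_distrib, ← Finset.mul_sum, Finset.sum_sub_distrib,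
    Finset.sum_ite_eq', mem_descendants, hℓ, hℓ', true_and]

/-- The total length of the edges above the vertices of `A`. -/
def len (T : WTree) (A : Finset ℕ) : ℝ := ∑ u ∈ A, T.d u

/-- The marginal potential of a leaf `ℓ` under the weight `z`. -/
def price (k : ℕ) (T : WTree) (z : ℕ → ℝ) (ℓ : ℕ) : ℝ :=
  ∑ u ∈ T.anc ℓ, T.d u * (20 * k + 10 * T.mass z u)

lemma price_sub_price (k : ℕ) (T : WTree) (z : ℕ → ℝ) (ℓ ℓ' : ℕ) :
    price k T z ℓ - price k T z ℓ' =
      ∑ u ∈ T.anc ℓ \ T.anc ℓ', T.d u * (20 * k + 10 * T.mass z u) -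
        ∑ u ∈ T.anc ℓ' \ T.anc ℓ, T.d u * (20 * k + 10 * T.mass z u) :=
  Finset.sum_sdiff_sub_sum_sdiff.symm

open scoped Classical in
lemma sum_anc (T : WTree) (f : ℕ → ℝ) (ℓ : ℕ) :
    ∑ u ∈ T.anc ℓ, f u = ∑ u ∈ T.V.erase T.root, if T.Desc ℓ u then f u else 0 := by
  rw [anc, Finset.sum_filter]

open scoped Classical in
lemma sum_anc_sdiff (T : WTree) (f : ℕ → ℝ) (ℓ ℓ' : ℕ) :
    ∑ u ∈ T.anc ℓ \ T.anc ℓ', f u =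
      ∑ u ∈ T.V.erase T.root, if T.Desc ℓ u ∧ ¬ T.Desc ℓ' u then f u else 0 := by
  rw [← Finset.sum_filter]
  congr 1
  ext u
  simp only [anc, Finset.mem_sdiff, Finset.mem_filter]
  tauto

/-- Since `φ` is quadratic, the second-order expansion is exact. Only edges on the path between the
two leaves change mass, and the common edges cancel in the price difference. -/
lemma Psi_shift (k : ℕ) (z : ℕ → ℝ) {ℓ ℓ' : ℕ} (hℓ : ℓ ∈ T.V) (hℓ' : ℓ' ∈ T.V) (t : ℝ) :
    T.Psi (pot k) (shift z ℓ ℓ' t) = T.Psi (pot k) z + t * (price k T z ℓ' - price k T z ℓ) +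
      5 * t ^ 2 * (T.len (T.anc ℓ \ T.anc ℓ') + T.len (T.anc ℓ' \ T.anc ℓ)) := by
  classical
  simp only [Psi, price, len, sum_anc, sum_anc_sdiff, ← Finset.sum_sub_distrib, Finset.mul_sum,
    ← Finset.sum_add_distrib]
  refine Finset.sum_congr rfl fun u _ => ?_
  rw [mass_shift z hℓ hℓ']
  unfold pot
  by_cases h1 : T.Desc ℓ u <;> by_cases h2 : T.Desc ℓ' u <;> simp [h1, h2] <;> ring

lemma OT_shift (z : ℕ → ℝ) {ℓ ℓ' : ℕ} (hℓ : ℓ ∈ T.V) (hℓ' : ℓ' ∈ T.V) {t : ℝ} (ht : 0 ≤ t) :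
    T.OT z (shift z ℓ ℓ' t) =
      t * (T.len (T.anc ℓ \ T.anc ℓ') + T.len (T.anc ℓ' \ T.anc ℓ)) := by
  classical
  simp only [OT, len, sum_anc_sdiff, Finset.mul_sum, ← Finset.sum_add_distrib]
  refine Finset.sum_congr rfl fun u _ => ?_
  rw [mass_shift z hℓ hℓ']
  by_cases h1 : T.Desc ℓ u <;> by_cases h2 : T.Desc ℓ' u <;> simp [h1, h2, abs_of_nonneg ht] <;>
    ring

lemma len_anc_sdiff_nonneg (T : WTree) (ℓ ℓ' : ℕ) : 0 ≤ T.len (T.anc ℓ \ T.anc ℓ') := by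
  refine Finset.sum_nonneg fun u hu => ?_
  obtain ⟨h1, h2, -⟩ := mem_anc.1 (Finset.mem_sdiff.1 hu).1
  exact (T.d_pos u h2 h1).le

/-- A transfer that does not decrease the potential goes to a leaf of larger marginal potential. -/
lemma price_le_price {k : ℕ} {z : ℕ → ℝ} {ℓ ℓ' : ℕ} (hℓ : ℓ ∈ T.V) (hℓ' : ℓ' ∈ T.V) {ε : ℝ}
    (hε : 0 < ε)
    (h : ∀ t, 0 < t → t ≤ ε → T.Psi (pot k) z ≤ T.Psi (pot k) (shift z ℓ ℓ' t)) :
    price k T z ℓ ≤ price k T z ℓ' := by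
  by_contra! hlt
  set K := T.len (T.anc ℓ \ T.anc ℓ') + T.len (T.anc ℓ' \ T.anc ℓ)
  have hK : 0 ≤ K := add_nonneg (len_anc_sdiff_nonneg T ℓ ℓ') (len_anc_sdiff_nonneg T ℓ' ℓ)
  set g := price k T z ℓ - price k T z ℓ' with hg
  have hg0 : 0 < g := by linarith
  have hd : 0 < 5 * K + 1 := by linarith
  -- The linear gain `t * g` beats the second-order loss `5 t² K` as soon as `5 t K < g`; the `+ 1`
  -- covers `K = 0`.
  set t := min ε (g / (5 * K + 1)) with ht
  have ht0 : 0 < t := lt_min hε (div_pos hg0 hd)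
  have h1 := h t ht0 (min_le_left _ _)
  rw [Psi_shift k z hℓ hℓ'] at h1
  have h2 : t * (5 * K + 1) ≤ g := (le_div_iff₀ hd).1 (min_le_right _ _)
  have h3 : 0 ≤ t * (5 * t * K - g) := by
    have : t * (5 * t * K - g) =
        t * (price k T z ℓ' - price k T z ℓ) + 5 * t ^ 2 * K := by rw [hg]; ring
    linarith
  have h4 : 5 * t * K - g < 0 := by nlinarith
  nlinarith

end WTree

/-! ### Configurations: strong convexity, optimality, stability and comparison -/

section Configs

variable {k : ℕ} {T : WTree}

lemma fracConfigs_nonneg {y : ℕ → ℝ} (hy : y ∈ fracConfigs k T) (v : ℕ) : 0 ≤ y v := by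
  by_cases h : v ∈ T.leaves
  · exact hy.2.1 v h
  · exact (hy.1 v h).ge

lemma mass_root_of_mem_fracConfigs {y : ℕ → ℝ} (hy : y ∈ fracConfigs k T) :
    T.mass y T.root = k := by
  rw [WTree.mass_root hy.1, hy.2.2]

lemma mass_le_of_mem_fracConfigs {y : ℕ → ℝ} (hy : y ∈ fracConfigs k T) {u : ℕ} (hu : u ∈ T.V) :
    T.mass y u ≤ k := by
  rw [← mass_root_of_mem_fracConfigs hy]
  exact WTree.mass_le_mass (fracConfigs_nonneg hy) (WTree.desc_root hu)

lemma le_of_mem_fracConfigs {y : ℕ → ℝ} (hy : y ∈ fracConfigs k T) (v : ℕ) : y v ≤ k := by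
  by_cases h : v ∈ T.leaves
  · rw [← WTree.mass_leaf y h]
    exact mass_le_of_mem_fracConfigs hy (WTree.mem_V_of_mem_leaves h)
  · rw [hy.1 v h]; positivity

lemma toFrac_mem_fracConfigs {x : ℕ → ℕ} (hx : x ∈ discreteConfigs k T) :
    toFrac x ∈ fracConfigs k T := by
  refine ⟨fun v hv => by simp [toFrac, hx.1 v hv], fun v _ => Nat.cast_nonneg _, ?_⟩
  rw [← hx.2]; push_cast; rfl

lemma le_of_mem_discreteConfigs {x : ℕ → ℕ} (hx : x ∈ discreteConfigs k T) (v : ℕ) : x v ≤ k := by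
  exact_mod_cast le_of_mem_fracConfigs (toFrac_mem_fracConfigs hx) v

lemma shift_mem_fracConfigs {y : ℕ → ℝ} (hy : y ∈ fracConfigs k T) {ℓ ℓ' : ℕ}
    (hℓ : ℓ ∈ T.leaves) (hℓ' : ℓ' ∈ T.leaves) {t : ℝ} (ht : 0 ≤ t) (hty : t ≤ y ℓ) :
    shift y ℓ ℓ' t ∈ fracConfigs k T := by
  refine ⟨fun v hv => ?_, fun v hv => ?_, ?_⟩
  · have h1 : v ≠ ℓ := fun h => hv (h ▸ hℓ)
    have h2 : v ≠ ℓ' := fun h => hv (h ▸ hℓ')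
    simp [shift, h1, h2, hy.1 v hv]
  · have := hy.2.1 v hv
    unfold shift
    split_ifs with h1 h2 h2
    · linarith
    · linarith
    · subst h2; linarith
    · linarith
  · simp only [shift, Finset.sum_add_distrib, ← Finset.mul_sum, Finset.sum_sub_distrib,
      Finset.sum_ite_eq', hℓ, hℓ', if_true, hy.2.2]
    ring

/-- The discrete configuration `x` after `n` robots have moved from `ℓ` to `ℓ'`. -/
def transfer (x : ℕ → ℕ) (ℓ ℓ' n : ℕ) (v : ℕ) : ℕ :=
  if v = ℓ then x v - n else if v = ℓ' then x v + n else x v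

lemma toFrac_transfer {x : ℕ → ℕ} {ℓ ℓ' n : ℕ} (hne : ℓ ≠ ℓ') (hn : n ≤ x ℓ) :
    toFrac (transfer x ℓ ℓ' n) = shift (toFrac x) ℓ ℓ' n := by
  funext v
  unfold toFrac transfer shift
  by_cases h1 : v = ℓ
  · subst h1
    simp only [if_true, if_neg hne]
    push_cast [Nat.cast_sub hn]
    ring
  · by_cases h2 : v = ℓ' <;> simp [h1, h2, hne.symm]

lemma transfer_mem_discreteConfigs {x : ℕ → ℕ} (hx : x ∈ discreteConfigs k T) {ℓ ℓ' n : ℕ}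
    (hℓ : ℓ ∈ T.leaves) (hℓ' : ℓ' ∈ T.leaves) (hne : ℓ ≠ ℓ') (hn : n ≤ x ℓ) :
    transfer x ℓ ℓ' n ∈ discreteConfigs k T := by
  have h := shift_mem_fracConfigs (toFrac_mem_fracConfigs hx) hℓ hℓ' (Nat.cast_nonneg n)
    (show ((n : ℕ) : ℝ) ≤ toFrac x ℓ from Nat.cast_le.2 hn)
  rw [← toFrac_transfer hne hn] at h
  refine ⟨fun v hv => ?_, ?_⟩
  · exact_mod_cast h.1 v hv
  · exact_mod_cast h.2.2

lemma Psi_nonneg (T : WTree) {z : ℕ → ℝ} (hz : ∀ v, 0 ≤ z v) : 0 ≤ T.Psi (pot k) z := by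
  refine Finset.sum_nonneg fun u hu => ?_
  obtain ⟨h1, h2⟩ := Finset.mem_erase.1 hu
  exact mul_nonneg (T.d_pos u h2 h1).le (pot_nonneg k (WTree.mass_nonneg hz u))

/-- Strong convexity of the potential at an optimal configuration. -/
lemma Psi_sub_ge {y z : ℕ → ℝ}
    (hmin : ∀ t, 0 < t → t ≤ 1 →
      T.Psi (pot k) y ≤ T.Psi (pot k) (fun v => (1 - t) * y v + t * z v)) :
    T.Psi (pot k) y + 5 * ∑ u ∈ T.V.erase T.root, T.d u * (T.mass z u - T.mass y u) ^ 2 ≤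
      T.Psi (pot k) z := by
  set S := ∑ u ∈ T.V.erase T.root, T.d u * (T.mass z u - T.mass y u) ^ 2 with hS
  set G := ∑ u ∈ T.V.erase T.root,
    T.d u * (20 * k + 10 * T.mass y u) * (T.mass z u - T.mass y u) with hG
  have hS0 : 0 ≤ S := Finset.sum_nonneg fun u hu =>
    mul_nonneg (T.d_pos u (Finset.mem_of_mem_erase hu) (Finset.ne_of_mem_erase hu)).le (sq_nonneg _)
  -- On the segment from `y` to `z` the potential is a quadratic polynomial in `t` with slope `G` at
  -- `0`. Minimality forces `0 ≤ G`, and `t = 1` then gives the claim.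
  have key : ∀ t : ℝ, T.Psi (pot k) (fun v => (1 - t) * y v + t * z v) =
      T.Psi (pot k) y + t * G + 5 * t ^ 2 * S := by
    intro t
    simp only [WTree.Psi, hS, hG, Finset.mul_sum, ← Finset.sum_add_distrib]
    refine Finset.sum_congr rfl fun u _ => ?_
    rw [WTree.mass_lincomb]
    unfold pot
    ring
  have hG0 : 0 ≤ G := by
    by_contra! hlt
    set t := min 1 (-G / (5 * S + 1)) with ht
    have hd : 0 < 5 * S + 1 := by linarith
    have ht0 : 0 < t := lt_min one_pos (div_pos (by linarith) hd)
    have h1 := hmin t ht0 (min_le_left _ _)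
    rw [key] at h1
    have h2 : t * (5 * S + 1) ≤ -G := (le_div_iff₀ hd).1 (min_le_right _ _)
    have h4 : 5 * t * S + G < 0 := by nlinarith
    nlinarith
  have h1 := key 1
  simp only [sub_self, zero_mul, one_mul, zero_add] at h1
  rw [h1]
  linarith

lemma convex_comb_mem_fracConfigs {y z : ℕ → ℝ} (hy : y ∈ fracConfigs k T)
    (hz : z ∈ fracConfigs k T) {t : ℝ} (ht : 0 ≤ t) (ht1 : t ≤ 1) :
    (fun v => (1 - t) * y v + t * z v) ∈ fracConfigs k T := by
  refine ⟨fun v hv => by simp [hy.1 v hv, hz.1 v hv], fun v hv => ?_, ?_⟩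
  · exact add_nonneg (mul_nonneg (by linarith) (hy.2.1 v hv)) (mul_nonneg ht (hz.2.1 v hv))
  · rw [Finset.sum_add_distrib, ← Finset.mul_sum, ← Finset.mul_sum, hy.2.2, hz.2.2]; ring

lemma IsOptimalFrac.add_le {y z : ℕ → ℝ} (hy : IsOptimalFrac (pot k) k T y)
    (hz : z ∈ fracConfigs k T) :
    T.Psi (pot k) y + 5 * ∑ u ∈ T.V.erase T.root, T.d u * (T.mass z u - T.mass y u) ^ 2 ≤
      T.Psi (pot k) z :=
  Psi_sub_ge fun _ ht ht1 => hy.2 (convex_comb_mem_fracConfigs hy.1 hz ht.le ht1)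

/-- The form in which strong convexity is used: `u` is a leaf whose weight is changed by a fork or a
deletion, or at which two optima are compared. -/
lemma IsOptimalFrac.add_sq_le {y z : ℕ → ℝ} (hy : IsOptimalFrac (pot k) k T y)
    (hz : z ∈ fracConfigs k T) {u : ℕ} (hu : u ∈ T.V) (hr : u ≠ T.root) :
    T.Psi (pot k) y + 5 * (T.d u * (T.mass z u - T.mass y u) ^ 2) ≤ T.Psi (pot k) z := by
  refine le_trans ?_ (hy.add_le hz)
  gcongr
  refine Finset.single_le_sum (f := fun u => T.d u * (T.mass z u - T.mass y u) ^ 2)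
    (fun v hv => ?_) (Finset.mem_erase.2 ⟨hr, hu⟩)
  exact mul_nonneg (T.d_pos v (Finset.mem_of_mem_erase hv) (Finset.ne_of_mem_erase hv)).le
    (sq_nonneg _)

/-- Strong convexity on the edge above a leaf determines its weight; a root that is a leaf carries
the fixed total `k`. -/
lemma IsOptimalFrac.eq {y z : ℕ → ℝ} (hy : IsOptimalFrac (pot k) k T y)
    (hz : IsOptimalFrac (pot k) k T z) : z = y := by
  funext v
  by_cases hv : v ∈ T.leaves
  · have hvV := WTree.mem_V_of_mem_leaves hv
    rw [← WTree.mass_leaf z hv, ← WTree.mass_leaf y hv]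
    by_cases hr : v = T.root
    · rw [hr, mass_root_of_mem_fracConfigs hy.1, mass_root_of_mem_fracConfigs hz.1]
    · have h1 := hy.add_sq_le hz.1 hvV hr
      have h2 : T.Psi (pot k) z ≤ T.Psi (pot k) y := hz.2 hy.1
      have h3 := T.d_pos v hvV hr
      have h4 : (T.mass z v - T.mass y v) ^ 2 ≤ 0 := by
        by_contra! h
        have := mul_pos h3 h
        linarith
      have h5 := pow_eq_zero_iff (two_ne_zero) |>.1 (le_antisymm h4 (sq_nonneg _))
      linarith
  · rw [hy.1.1 v hv, hz.1.1 v hv]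

lemma exists_isOptimalFrac (k : ℕ) (T : WTree) : ∃ y, IsOptimalFrac (pot k) k T y := by
  have hc : IsCompact (fracConfigs k T) := by
    -- Configurations live in the infinite product `ℕ → ℝ`, so compactness comes from Tychonoff's
    -- theorem.
    have h1 : IsCompact (Set.univ.pi fun _ : ℕ => Set.Icc (0 : ℝ) k) :=
      isCompact_univ_pi fun _ => isCompact_Icc
    refine h1.of_isClosed_subset ?_ fun y hy v _ =>
      ⟨fracConfigs_nonneg hy v, le_of_mem_fracConfigs hy v⟩
    have : fracConfigs k T = {y : ℕ → ℝ | ∀ v, v ∉ T.leaves → y v = 0} ∩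
        ({y : ℕ → ℝ | ∀ ℓ ∈ T.leaves, 0 ≤ y ℓ} ∩ {y : ℕ → ℝ | ∑ ℓ ∈ T.leaves, y ℓ = k}) := rfl
    rw [this]
    refine IsClosed.inter ?_ (IsClosed.inter ?_ ?_)
    · simp only [Set.ofPred_forall]
      exact isClosed_iInter fun v => isClosed_iInter fun _ =>
        isClosed_eq (continuous_apply v) continuous_const
    · simp only [Set.ofPred_forall]
      exact isClosed_iInter fun v => isClosed_iInter fun _ =>
        isClosed_le continuous_const (continuous_apply v)
    · exact isClosed_eq (continuous_finsetSum _ fun v _ => continuous_apply v) continuous_const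
  have hne : (fracConfigs k T).Nonempty := by
    obtain ⟨ℓ, hℓ, -⟩ := WTree.exists_leaf_desc T.root_mem
    refine ⟨fun v => if v = ℓ then (k : ℝ) else 0, fun v hv => ?_, fun v _ => ?_, ?_⟩
    · exact if_neg fun h : v = ℓ => hv (h ▸ hℓ)
    · dsimp only
      split_ifs <;> positivity
    · simp [hℓ]
  have hcont : Continuous (T.Psi (pot k)) := by
    unfold WTree.Psi pot
    simp only [WTree.mass_eq]
    fun_prop
  obtain ⟨y, hy, hmin⟩ := hc.exists_isMinOn hne hcont.continuousOn
  exact ⟨y, hy, hmin⟩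

lemma IsOptimalFrac.price_le {y : ℕ → ℝ} (hy : IsOptimalFrac (pot k) k T y) {ℓ ℓ' : ℕ}
    (hℓ : ℓ ∈ T.leaves) (hℓ' : ℓ' ∈ T.leaves) (hpos : 0 < y ℓ) :
    WTree.price k T y ℓ ≤ WTree.price k T y ℓ' :=
  WTree.price_le_price (WTree.mem_V_of_mem_leaves hℓ) (WTree.mem_V_of_mem_leaves hℓ') hpos
    fun _ ht hty => hy.2 (shift_mem_fracConfigs hy.1 hℓ hℓ' ht.le hty)

/-- The non-strict form of `Stable`. -/
def WeaklyStable (k : ℕ) (T : WTree) (x : ℕ → ℕ) : Prop :=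
  ∀ x' ∈ discreteConfigs k T,
    T.Psi (pot k) (toFrac x) ≤ T.Psi (pot k) (toFrac x') + T.OT (toFrac x) (toFrac x')

lemma OT_self (T : WTree) (z : ℕ → ℝ) : T.OT z z = 0 := by simp [WTree.OT]

lemma Stable.weaklyStable {x : ℕ → ℕ} (h : Stable (pot k) k T x) : WeaklyStable k T x := by
  intro x' hx'
  by_cases hne : x' = x
  · subst hne
    simp [OT_self]
  · linarith [h x' hx' hne]

/-- Test stability against the move of a single robot: of the `6`, a share `5` is the second-order
term of `Ψ` and `1` is the transport cost. -/
lemma WeaklyStable.price_sub_le {x : ℕ → ℕ} (h : WeaklyStable k T x)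
    (hx : x ∈ discreteConfigs k T) {ℓ ℓ' : ℕ} (hℓ : ℓ ∈ T.leaves) (hℓ' : ℓ' ∈ T.leaves)
    (hne : ℓ ≠ ℓ') (h1 : 1 ≤ x ℓ) :
    WTree.price k T (toFrac x) ℓ - WTree.price k T (toFrac x) ℓ' ≤
      6 * (T.len (T.anc ℓ \ T.anc ℓ') + T.len (T.anc ℓ' \ T.anc ℓ)) := by
  have h2 := h _ (transfer_mem_discreteConfigs hx hℓ hℓ' hne h1)
  rw [toFrac_transfer hne h1, WTree.Psi_shift k _ (WTree.mem_V_of_mem_leaves hℓ)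
    (WTree.mem_V_of_mem_leaves hℓ'), WTree.OT_shift _ (WTree.mem_V_of_mem_leaves hℓ)
    (WTree.mem_V_of_mem_leaves hℓ') (Nat.cast_nonneg _)] at h2
  push_cast at h2
  linarith

/-- In a stable configuration, the number of robots at a leaf exceeds the optimal fractional number
by little. -/
lemma WeaklyStable.le_add {x : ℕ → ℕ} {y : ℕ → ℝ} (hk : 0 < k) (h : WeaklyStable k T x)
    (hx : x ∈ discreteConfigs k T) (hy : IsOptimalFrac (pot k) k T y) {ℓ : ℕ}
    (hℓ : ℓ ∈ T.leaves) : (x ℓ : ℝ) ≤ 6 / 5 + (1 + 3 / (10 * k)) * y ℓ := by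
  have hk' : (0 : ℝ) < k := Nat.cast_pos.2 hk
  by_contra! hlt
  -- This `q` satisfies `q * 20k = 20k + 6`, so scaling the marginals of `y` by `q` absorbs the `6`
  -- of `price_sub_le`.
  set q : ℝ := 1 + 3 / (10 * k) with hq
  have hq1 : 1 < q := by
    rw [hq, lt_add_iff_pos_right]
    positivity
  have hqk : q * k = k + 3 / 10 := by rw [hq]; field_simp
  set z : ℕ → ℝ := fun v => 1 * toFrac x v + (-q) * y v with hz
  have hmass : ∀ u, T.mass z u = T.mass (toFrac x) u - q * T.mass y u := fun u => by
    rw [hz, WTree.mass_lincomb]; ring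
  have hxf := toFrac_mem_fracConfigs hx
  obtain ⟨ℓ', hℓ', h1, h2, h3⟩ := WTree.exists_exchange (T := T) z
    (fun v hv => by simp [hz, hx.1 v hv, hy.1.1 v hv]) (6 / 5) (WTree.mem_V_of_mem_leaves hℓ)
    (by rw [hmass, WTree.mass_leaf _ hℓ, WTree.mass_leaf _ hℓ]; simp only [toFrac]; linarith)
    (by rw [hmass, mass_root_of_mem_fracConfigs hxf, mass_root_of_mem_fracConfigs hy.1]; linarith)
  have hy0 : 0 ≤ y ℓ := fracConfigs_nonneg hy.1 ℓ
  have hypos : 0 < y ℓ' := by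
    rw [hmass, WTree.mass_leaf _ hℓ', WTree.mass_leaf _ hℓ'] at h1
    have : (0 : ℝ) ≤ x ℓ' := Nat.cast_nonneg _
    simp only [toFrac] at h1
    by_contra! hc
    nlinarith
  have hx1 : 1 ≤ x ℓ := by
    rw [Nat.one_le_iff_ne_zero]
    intro h0
    rw [h0] at hlt
    push_cast at hlt
    nlinarith
  have hne : ℓ ≠ ℓ' := by
    rintro rfl
    rw [hmass, WTree.mass_leaf _ hℓ, WTree.mass_leaf _ hℓ] at h1
    simp only [toFrac] at h1
    linarith
  have hs := h.price_sub_le hx hℓ hℓ' hne hx1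
  have hp := hy.price_le hℓ' hℓ hypos
  rw [WTree.price_sub_price] at hs
  rw [← sub_nonneg, WTree.price_sub_price] at hp
  have hd : ∀ {v w u}, u ∈ T.anc v \ T.anc w → 0 < T.d u := by
    intro v w u hu
    obtain ⟨h1, h2, -⟩ := WTree.mem_anc.1 (Finset.mem_sdiff.1 hu).1
    exact T.d_pos u h2 h1
  -- On the side of `ℓ` the threshold `6 / 5` contributes `10 * 6 / 5 = 12`, which covers the `6`
  -- subtracted here and the `6` contained in `q`. With `hB`, the price gap under `x` minus `6`
  -- times the path length exceeds `q` times the gap under `y`, which is nonnegative; this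
  -- contradicts stability.
  have hA : ∑ u ∈ T.anc ℓ \ T.anc ℓ', T.d u * (q * (20 * k + 10 * T.mass y u)) <
      ∑ u ∈ T.anc ℓ \ T.anc ℓ', T.d u * (20 * k + 10 * T.mass (toFrac x) u - 6) := by
    refine Finset.sum_lt_sum_of_nonempty ⟨ℓ, ?_⟩ fun u hu => ?_
    · rw [Finset.mem_sdiff, WTree.mem_anc, WTree.mem_anc]
      have hr : ℓ ≠ T.root := by
        rintro rfl
        rw [← WTree.mass_leaf y hℓ, mass_root_of_mem_fracConfigs hy.1] at hlt
        have := le_of_mem_fracConfigs hxf T.root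
        simp only [toFrac] at this
        nlinarith
      exact ⟨⟨hr, WTree.mem_V_of_mem_leaves hℓ, WTree.Desc.refl T ℓ⟩, fun h => hne
        (WTree.eq_of_desc_leaf (WTree.mem_V_of_mem_leaves hℓ') hℓ h.2.2).symm⟩
    · have := h2 u hu
      rw [hmass] at this
      refine mul_lt_mul_of_pos_left ?_ (hd hu)
      nlinarith
  have hB : ∑ u ∈ T.anc ℓ' \ T.anc ℓ, T.d u * (20 * k + 10 * T.mass (toFrac x) u + 6) ≤
      ∑ u ∈ T.anc ℓ' \ T.anc ℓ, T.d u * (q * (20 * k + 10 * T.mass y u)) := by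
    refine Finset.sum_le_sum fun u hu => ?_
    have := h3 u hu
    rw [hmass] at this
    refine mul_le_mul_of_nonneg_left ?_ (hd hu).le
    nlinarith
  simp only [mul_left_comm _ q, ← Finset.mul_sum] at hA hB
  simp only [mul_sub, mul_add, Finset.sum_sub_distrib, Finset.sum_add_distrib, WTree.len,
    ← Finset.sum_mul] at hA hB hs hp
  nlinarith

/-- A leaf whose marginal potential is not larger than that of any loaded leaf under `y'` carries at
least as much under `y'` as under `y`. -/
lemma le_of_price_le {y y' : ℕ → ℝ} (hy : IsOptimalFrac (pot k) k T y)
    (hy' : y' ∈ fracConfigs k T) {ℓ : ℕ} (hℓ : ℓ ∈ T.leaves)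
    (h : ∀ ℓ' ∈ T.leaves, ℓ' ≠ ℓ → 0 < y' ℓ' →
      ∑ u ∈ T.anc ℓ' \ T.anc ℓ, T.d u * (20 * k + 10 * T.mass y' u) ≤
        ∑ u ∈ T.anc ℓ \ T.anc ℓ', T.d u * (20 * k + 10 * T.mass y' u)) :
    y ℓ ≤ y' ℓ := by
  by_contra! hlt
  -- Along the exchange path `y` exceeds `y'` on the side of `ℓ` and is below it on the side of
  -- `ℓ'`. Marginals increase with mass, so `ℓ`, at least as expensive as `ℓ'` under `y'`, is
  -- strictly more expensive under `y`, although `y` loads it.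
  obtain ⟨ℓ', hℓ', h1, h2, h3⟩ := WTree.exists_exchange (T := T) (fun v => y v - y' v)
    (fun v hv => by simp [hy'.1 v hv, hy.1.1 v hv]) 0 (WTree.mem_V_of_mem_leaves hℓ)
    (by rw [WTree.mass_sub, WTree.mass_leaf _ hℓ, WTree.mass_leaf _ hℓ]; linarith)
    (by rw [WTree.mass_sub, mass_root_of_mem_fracConfigs hy', mass_root_of_mem_fracConfigs hy.1,
      sub_self])
  simp only [WTree.mass_sub] at h1 h2 h3
  have hV := WTree.mem_V_of_mem_leaves hℓ
  have hr : ℓ ≠ T.root := by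
    rintro rfl
    rw [← WTree.mass_leaf y hℓ, ← WTree.mass_leaf y' hℓ, mass_root_of_mem_fracConfigs hy.1,
      mass_root_of_mem_fracConfigs hy'] at hlt
    exact lt_irrefl _ hlt
  rw [WTree.mass_leaf _ hℓ', WTree.mass_leaf _ hℓ'] at h1
  have hne : ℓ' ≠ ℓ := by
    rintro rfl
    linarith
  have h4 := h ℓ' hℓ' hne (by linarith [fracConfigs_nonneg hy.1 ℓ'])
  have h5 := hy.price_le hℓ hℓ' (by linarith [fracConfigs_nonneg hy' ℓ])
  rw [← sub_nonneg, WTree.price_sub_price] at h5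
  have hd : ∀ {v w u}, u ∈ T.anc v \ T.anc w → 0 < T.d u := by
    intro v w u hu
    obtain ⟨h1, h2, -⟩ := WTree.mem_anc.1 (Finset.mem_sdiff.1 hu).1
    exact T.d_pos u h2 h1
  have hA : ∑ u ∈ T.anc ℓ \ T.anc ℓ', T.d u * (20 * k + 10 * T.mass y' u) <
      ∑ u ∈ T.anc ℓ \ T.anc ℓ', T.d u * (20 * k + 10 * T.mass y u) := by
    refine Finset.sum_lt_sum_of_nonempty ⟨ℓ, ?_⟩ fun u hu => ?_
    · rw [Finset.mem_sdiff, WTree.mem_anc, WTree.mem_anc]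
      exact ⟨⟨hr, hV, WTree.Desc.refl T ℓ⟩, fun h => hne
        (WTree.eq_of_desc_leaf (WTree.mem_V_of_mem_leaves hℓ') hℓ h.2.2)⟩
    · exact mul_lt_mul_of_pos_left (by linarith [h2 u hu]) (hd hu)
  have hB : ∑ u ∈ T.anc ℓ' \ T.anc ℓ, T.d u * (20 * k + 10 * T.mass y u) ≤
      ∑ u ∈ T.anc ℓ' \ T.anc ℓ, T.d u * (20 * k + 10 * T.mass y' u) :=
    Finset.sum_le_sum fun u hu => mul_le_mul_of_nonneg_left (by linarith [h3 u hu]) (hd hu).le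
  linarith

end Configs

/-! ### The invariant and its preservation under elongation -/

/-- The invariant of the game: the optimal fractional configuration puts a weight of at least
`1 / 2` on every leaf, and its potential controls the accumulated cost. -/
def Invariant (k : ℕ) (T : WTree) (x : ℕ → ℕ) (c : ℝ) : Prop :=
  x ∈ discreteConfigs k T ∧ ∀ y, IsOptimalFrac (pot k) k T y →
    (∀ ℓ ∈ T.leaves, 1 / 2 ≤ y ℓ) ∧ c + T.Psi (pot k) (toFrac x) ≤ 48 * T.Psi (pot k) y

section Elongate

variable {k : ℕ} {T : WTree}

/-- For `k ≥ 2` the slope in `le_add` is at most `23 / 20`, so two robots force `y ℓ ≥ 16 / 23`, and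
`(x - 6 / 5) / (23 / 20) ≥ 17 x / 50` from `x = 2` on. -/
lemma WeaklyStable.lower_bounds {x : ℕ → ℕ} {y : ℕ → ℝ} (hk : 2 ≤ k) (h : WeaklyStable k T x)
    (hx : x ∈ discreteConfigs k T) (hy : IsOptimalFrac (pot k) k T y) {ℓ : ℕ}
    (hℓ : ℓ ∈ T.leaves) (h2 : 2 ≤ x ℓ) : 1 / 2 ≤ y ℓ ∧ 17 / 50 * (x ℓ : ℝ) ≤ y ℓ := by
  have h1 := h.le_add (by omega) hx hy hℓ
  have hk' : (2 : ℝ) ≤ k := by exact_mod_cast hk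
  have h3 : (2 : ℝ) ≤ x ℓ := by exact_mod_cast h2
  have h4 : 3 / (10 * (k : ℝ)) ≤ 3 / 20 := by
    rw [div_le_div_iff₀ (by positivity) (by norm_num)]; linarith
  have h5 := fracConfigs_nonneg hy.1 ℓ
  have h6 := mul_le_mul_of_nonneg_right h4 h5
  constructor <;> linarith

lemma Psi_elongate (φ : ℝ → ℝ) (T : WTree) (g : ℕ → NNReal) (z : ℕ → ℝ) :
    (T.elongate g).Psi φ z =
      T.Psi φ z + ∑ u ∈ T.V.erase T.root, (g u : ℝ) * φ (T.mass z u) := by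
  change ∑ u ∈ T.V.erase T.root, (T.d u + g u) * φ (T.mass z u) = _
  simp only [add_mul, Finset.sum_add_distrib]
  rfl

lemma elongate_of_eq_zero (T : WTree) {g : ℕ → NNReal} (hg : ∀ u, g u = 0) : T.elongate g = T := by
  have : (fun u => T.d u + g u) = T.d := by
    funext u
    simp [hg u]
  cases T
  simp only [WTree.elongate, this]

/-- The growth only adds to the prices of elongated leaves, hence not to that of `ℓ`. The optimality
of `y'` in the longer tree thus yields the price inequality in `T` that `le_of_price_le` requires.
-/
lemma le_of_elongate {g : ℕ → NNReal} (hg : ∀ u, g u ≠ 0 → u ∈ T.leaves) {y y' : ℕ → ℝ}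
    (hy : IsOptimalFrac (pot k) k T y) (hy' : IsOptimalFrac (pot k) k (T.elongate g) y') {ℓ : ℕ}
    (hℓ : ℓ ∈ T.leaves) (h0 : g ℓ = 0) : y ℓ ≤ y' ℓ := by
  refine le_of_price_le hy hy'.1 hℓ fun ℓ' hℓ' _ hpos => ?_
  have h1 := hy'.price_le hℓ' hℓ hpos
  rw [← sub_nonneg, WTree.price_sub_price] at h1
  replace h1 : 0 ≤ ∑ u ∈ T.anc ℓ \ T.anc ℓ', (T.d u + g u) * (20 * k + 10 * T.mass y' u) -
      ∑ u ∈ T.anc ℓ' \ T.anc ℓ, (T.d u + g u) * (20 * k + 10 * T.mass y' u) := h1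
  have h2 : ∑ u ∈ T.anc ℓ \ T.anc ℓ', (T.d u + g u) * (20 * k + 10 * T.mass y' u) =
      ∑ u ∈ T.anc ℓ \ T.anc ℓ', T.d u * (20 * k + 10 * T.mass y' u) := by
    refine Finset.sum_congr rfl fun u hu => ?_
    have : g u = 0 := by
      by_contra hne
      obtain ⟨-, -, h⟩ := WTree.mem_anc.1 (Finset.mem_sdiff.1 hu).1
      rw [← WTree.eq_of_desc_leaf (WTree.mem_V_of_mem_leaves hℓ) (hg u hne) h] at hne
      exact hne h0
    simp [this]
  have h3 : ∑ u ∈ T.anc ℓ' \ T.anc ℓ, T.d u * (20 * k + 10 * T.mass y' u) ≤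
      ∑ u ∈ T.anc ℓ' \ T.anc ℓ, (T.d u + g u) * (20 * k + 10 * T.mass y' u) := by
    refine Finset.sum_le_sum fun u _ => ?_
    have := WTree.mass_nonneg (T := T) (fracConfigs_nonneg hy'.1) u
    exact mul_le_mul_of_nonneg_right (le_add_of_nonneg_right (g u).2) (by positivity)
  linarith

/-- The whole elongation is treated in one step: `x` is constant and stability at the end suffices.
The edges of `T` cost `y'` at least as much as `y`, so only the growth has to be compared, edge by
edge. -/
lemma Invariant.elongate {x : ℕ → ℕ} {c : ℝ} (hk : 2 ≤ k) (h : Invariant k T x c) {g : ℕ → NNReal}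
    (hg : ∀ u, g u ≠ 0 → u ∈ T.leaves ∧ 2 ≤ x u) (hs : WeaklyStable k (T.elongate g) x) :
    Invariant k (T.elongate g) x (c + ∑ u ∈ T.V.erase T.root, (g u : ℝ) * x u) := by
  refine ⟨h.1, fun y' hy' => ?_⟩
  obtain ⟨y, hy⟩ := exists_isOptimalFrac k T
  obtain ⟨h1, h2⟩ := h.2 y hy
  refine ⟨fun ℓ hℓ => ?_, ?_⟩
  · by_cases h0 : g ℓ = 0
    · exact (h1 ℓ hℓ).trans (le_of_elongate (fun u hu => (hg u hu).1) hy hy' hℓ h0)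
    · exact (hs.lower_bounds hk h.1 hy' hℓ (hg ℓ h0).2).1
  · have h3 : T.Psi (pot k) y ≤ T.Psi (pot k) y' := hy.2 hy'.1
    -- On each grown edge, `x + φ(x) ≤ 26 k x`, while `48 φ(y') ≥ 48 * 20 k * (17 / 50) x`.
    have h4 : ∑ u ∈ T.V.erase T.root, (g u : ℝ) * x u +
        ∑ u ∈ T.V.erase T.root, (g u : ℝ) * pot k (T.mass (toFrac x) u) ≤
        48 * ∑ u ∈ T.V.erase T.root, (g u : ℝ) * pot k (T.mass y' u) := by
      rw [← Finset.sum_add_distrib, Finset.mul_sum]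
      refine Finset.sum_le_sum fun u _ => ?_
      by_cases h0 : g u = 0
      · simp [h0]
      · obtain ⟨hu, hu2⟩ := hg u h0
        have h5 := (hs.lower_bounds hk h.1 hy' hu hu2).2
        rw [WTree.mass_leaf _ hu, WTree.mass_leaf _ hu]
        have h6 := linear_le_pot k (y' u)
        have h7 := pot_le_linear k (Nat.cast_nonneg (x u))
          (Nat.cast_le.2 (le_of_mem_discreteConfigs h.1 u))
        have h8 : (1 : ℝ) ≤ k := by exact_mod_cast (by omega : 1 ≤ k)
        have h9 : (0 : ℝ) ≤ x u := Nat.cast_nonneg _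
        have h10 : (x u : ℝ) ≤ k * x u := le_mul_of_one_le_left h9 h8
        have h11 : (k : ℝ) * (17 / 50 * x u) ≤ k * y' u := by gcongr
        have : (x u : ℝ) + pot k (x u) ≤ 48 * pot k (y' u) := by nlinarith
        calc (g u : ℝ) * x u + g u * pot k (toFrac x u) = g u * (x u + pot k (x u)) := by
              simp only [toFrac]; ring
          _ ≤ g u * (48 * pot k (y' u)) := mul_le_mul_of_nonneg_left this (g u).2
          _ = _ := by ring
    rw [Psi_elongate, Psi_elongate]
    linarith

lemma grown_set_subset (lf : ℝ → ℕ) (τ : ℝ) (u : ℕ) :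
    {σ : ℝ | 0 ≤ σ ∧ σ < τ ∧ lf σ = u} ⊆ Set.Ico 0 τ := fun _ h => ⟨h.1, h.2.1⟩

lemma coe_grown (lf : ℝ → ℕ) (τ : ℝ) (u : ℕ) :
    (grown lf τ u : ℝ) = volume.real {σ : ℝ | 0 ≤ σ ∧ σ < τ ∧ lf σ = u} := rfl

lemma volume_grown_ne_top (lf : ℝ → ℕ) (τ : ℝ) (u : ℕ) :
    volume {σ : ℝ | 0 ≤ σ ∧ σ < τ ∧ lf σ = u} ≠ ⊤ :=
  ne_top_of_le_ne_top (by simp) (measure_mono (grown_set_subset lf τ u))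

lemma grown_le_add (lf : ℝ → ℕ) {τ s : ℝ} (h : τ ≤ s) (u : ℕ) :
    (grown lf τ u : ℝ) ≤ grown lf s u ∧ (grown lf s u : ℝ) ≤ grown lf τ u + (s - τ) := by
  simp only [coe_grown]
  constructor
  · exact measureReal_mono (fun σ hσ => ⟨hσ.1, hσ.2.1.trans_le h, hσ.2.2⟩)
      (volume_grown_ne_top lf s u)
  · have h1 : volume.real {σ : ℝ | 0 ≤ σ ∧ σ < s ∧ lf σ = u} ≤
        volume.real ({σ : ℝ | 0 ≤ σ ∧ σ < τ ∧ lf σ = u} ∪ Set.Ico τ s) := by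
      refine measureReal_mono (fun σ hσ => ?_) ?_
      · rcases lt_or_ge σ τ with h1 | h1
        · exact Or.inl ⟨hσ.1, h1, hσ.2.2⟩
        · exact Or.inr ⟨h1, hσ.2.1⟩
      · exact measure_union_ne_top (volume_grown_ne_top lf τ u) (by simp)
    refine h1.trans ((measureReal_union_le _ _).trans ?_)
    simp [Real.volume_real_Ico_of_le h]

lemma tendsto_grown (lf : ℝ → ℕ) (s : ℝ) (u : ℕ) :
    Filter.Tendsto (fun τ => (grown lf τ u : ℝ)) (nhdsWithin s (Set.Iio s))
      (nhds (grown lf s u : ℝ)) := by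
  have h1 : Filter.Tendsto (fun τ : ℝ => (grown lf s u : ℝ) - (s - τ))
      (nhdsWithin s (Set.Iio s)) (nhds (grown lf s u : ℝ)) := by
    have : Continuous fun τ : ℝ => (grown lf s u : ℝ) - (s - τ) := by fun_prop
    have := (this.tendsto s).mono_left (nhdsWithin_le_nhds (s := Set.Iio s))
    simpa using this
  refine tendsto_of_tendsto_of_tendsto_of_le_of_le' h1 tendsto_const_nhds ?_ ?_
  · filter_upwards [self_mem_nhdsWithin] with τ hτ
    linarith [(grown_le_add lf (le_of_lt hτ) u).2]
  · filter_upwards [self_mem_nhdsWithin] with τ hτ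
    exact (grown_le_add lf (le_of_lt hτ) u).1

/-- Stability persists, in its non-strict form, at the end of an elongation. -/
lemma weaklyStable_elongate {x : ℕ → ℕ} {s : ℝ} (hs : 0 < s) (lf : ℝ → ℕ)
    (hstable : ∀ τ, 0 ≤ τ → τ < s → Stable (pot k) k (T.elongate (grown lf τ)) x) :
    WeaklyStable k (T.elongate (grown lf s)) x := by
  intro x' hx'
  have hPsi : ∀ z, Filter.Tendsto (fun τ => (T.elongate (grown lf τ)).Psi (pot k) z)
      (nhdsWithin s (Set.Iio s)) (nhds ((T.elongate (grown lf s)).Psi (pot k) z)) := by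
    intro z
    simp only [Psi_elongate]
    exact tendsto_const_nhds.add
      (tendsto_finsetSum _ fun u _ => (tendsto_grown lf s u).mul_const _)
  have hOT : Filter.Tendsto (fun τ => (T.elongate (grown lf τ)).OT (toFrac x) (toFrac x'))
      (nhdsWithin s (Set.Iio s))
      (nhds ((T.elongate (grown lf s)).OT (toFrac x) (toFrac x'))) :=
    tendsto_finsetSum _ fun u _ =>
      (tendsto_const_nhds.add (tendsto_grown lf s u)).mul_const _
  refine le_of_tendsto_of_tendsto (hPsi _) ((hPsi _).add hOT) ?_
  filter_upwards [Ioo_mem_nhdsLT hs] with τ hτ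
  exact (hstable τ hτ.1.le hτ.2).weaklyStable x' hx'

/-- The cost of an elongation. -/
lemma integral_elongate {x : ℕ → ℕ} {s : ℝ} (hs : 0 ≤ s) (lf : ℝ → ℕ) (hmeas : Measurable lf)
    (hlf : ∀ σ, 0 ≤ σ → σ < s → lf σ ∈ T.leaves ∧ lf σ ≠ T.root ∧ 2 ≤ x (lf σ)) :
    ∫ σ in (0 : ℝ)..s, (x (lf σ) : ℝ) =
      ∑ u ∈ T.V.erase T.root, (grown lf s u : ℝ) * x u := by
  rw [intervalIntegral.integral_of_le hs, ← integral_Ico_eq_integral_Ioc]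
  have h1 : ∀ σ ∈ Set.Ico (0 : ℝ) s, (x (lf σ) : ℝ) =
      ∑ u ∈ T.V.erase T.root, (lf ⁻¹' {u}).indicator (fun _ => (x u : ℝ)) σ := by
    intro σ hσ
    obtain ⟨h1, h2, -⟩ := hlf σ hσ.1 hσ.2
    rw [Finset.sum_eq_single_of_mem (lf σ)
      (Finset.mem_erase.2 ⟨h2, WTree.mem_V_of_mem_leaves h1⟩)]
    · simp
    · intro u _ hu
      simp [hu.symm]
  rw [setIntegral_congr_fun measurableSet_Ico h1, integral_finsetSum]
  · refine Finset.sum_congr rfl fun u _ => ?_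
    have hm : MeasurableSet (lf ⁻¹' {u}) := hmeas (measurableSet_singleton u)
    rw [integral_indicator hm, setIntegral_const, measureReal_restrict_apply hm,
      coe_grown, smul_eq_mul]
    congr 2
    ext σ
    simp only [Set.mem_inter_iff, Set.mem_preimage, Set.mem_singleton_iff, Set.mem_Ico,
      Set.mem_ofPred_eq]
    tauto
  · intro u _
    exact (integrable_const _).indicator (hmeas (measurableSet_singleton u))

lemma Invariant.elongate_grown {x : ℕ → ℕ} {c s : ℝ} (hk : 2 ≤ k) (h : Invariant k T x c)
    (hs : 0 ≤ s) (lf : ℝ → ℕ) (hmeas : Measurable lf)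
    (hlf : ∀ σ, 0 ≤ σ → σ < s → lf σ ∈ T.leaves ∧ lf σ ≠ T.root ∧ 2 ≤ x (lf σ))
    (hstable : ∀ τ, 0 ≤ τ → τ < s → Stable (pot k) k (T.elongate (grown lf τ)) x) :
    Invariant k (T.elongate (grown lf s)) x (c + ∫ σ in (0 : ℝ)..s, (x (lf σ) : ℝ)) := by
  have hhit : ∀ u, grown lf s u ≠ 0 → u ∈ T.leaves ∧ 2 ≤ x u := by
    intro u hu
    have hne : {σ : ℝ | 0 ≤ σ ∧ σ < s ∧ lf σ = u}.Nonempty := by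
      rw [Set.nonempty_iff_ne_empty]
      intro he
      apply hu
      simp only [grown, he, measure_empty, ENNReal.toNNReal_zero]
    obtain ⟨σ, h0, h1, rfl⟩ := hne
    obtain ⟨h2, -, h3⟩ := hlf σ h0 h1
    exact ⟨h2, h3⟩
  -- A duration `0` gives no stability hypothesis, but then nothing changes.
  rcases hs.eq_or_lt with rfl | hpos
  · rw [elongate_of_eq_zero T, intervalIntegral.integral_same, add_zero]
    · exact h
    · intro u
      by_contra hu
      apply hu
      have : {σ : ℝ | 0 ≤ σ ∧ σ < 0 ∧ lf σ = u} = ∅ := by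
        ext σ
        simp only [Set.mem_ofPred_eq, Set.mem_empty_iff_false, iff_false]
        rintro ⟨h1, h2, -⟩
        linarith
      simp only [grown, this, measure_empty, ENNReal.toNNReal_zero]
  · rw [integral_elongate hs lf hmeas hlf]
    exact h.elongate hk hhit (weaklyStable_elongate hpos lf hstable)

end Elongate

/-! ### Forks -/

section Fork

variable {k : ℕ} {T T' : WTree} {ℓ : ℕ} {C : Finset ℕ} {len : ℝ}

namespace IsFork

lemma leaf (h : IsFork T ℓ C len T') : ℓ ∈ T.leaves := h.1

lemma disjoint (h : IsFork T ℓ C len T') : Disjoint T.V C := h.2.1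

lemma V_eq (h : IsFork T ℓ C len T') : T'.V = T.V ∪ C := h.2.2.1

lemma root_eq (h : IsFork T ℓ C len T') : T'.root = T.root := h.2.2.2.1

lemma leaf_mem (h : IsFork T ℓ C len T') : ℓ ∈ T.V := WTree.mem_V_of_mem_leaves h.leaf

lemma not_mem (h : IsFork T ℓ C len T') {v : ℕ} (hv : v ∈ T.V) : v ∉ C :=
  Finset.disjoint_left.1 h.disjoint hv

lemma not_mem_V (h : IsFork T ℓ C len T') {c : ℕ} (hc : c ∈ C) : c ∉ T.V :=
  Finset.disjoint_right.1 h.disjoint hc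

lemma ne_root (h : IsFork T ℓ C len T') {c : ℕ} (hc : c ∈ C) : c ≠ T.root :=
  fun he => h.not_mem_V hc (he ▸ T.root_mem)

lemma leaf_ne (h : IsFork T ℓ C len T') {c : ℕ} (hc : c ∈ C) : ℓ ≠ c :=
  fun he => h.not_mem h.leaf_mem (he ▸ hc)

lemma parent_eq (h : IsFork T ℓ C len T') {u : ℕ} (hu : u ∈ T.V) : T'.parent u = T.parent u := by
  by_cases hr : u = T.root
  · subst hr
    rw [T.parent_root]
    have := T'.parent_root
    rwa [h.root_eq] at this
  · exact (h.2.2.2.2.1 u hu hr).1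

lemma d_eq (h : IsFork T ℓ C len T') {u : ℕ} (hu : u ∈ T.V) (hr : u ≠ T.root) :
    T'.d u = T.d u := (h.2.2.2.2.1 u hu hr).2

lemma parent_new (h : IsFork T ℓ C len T') {c : ℕ} (hc : c ∈ C) : T'.parent c = ℓ :=
  (h.2.2.2.2.2 c hc).1

lemma d_new (h : IsFork T ℓ C len T') {c : ℕ} (hc : c ∈ C) : T'.d c = len :=
  (h.2.2.2.2.2 c hc).2

lemma desc_iff (h : IsFork T ℓ C len T') {u : ℕ} (hu : u ∈ T.V) (v : ℕ) :
    T'.Desc u v ↔ T.Desc u v := by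
  have : ∀ n, T'.parent^[n] u = T.parent^[n] u := by
    intro n
    induction n with
    | zero => rfl
    | succ n ih =>
      rw [Function.iterate_succ_apply', Function.iterate_succ_apply', ih,
        h.parent_eq (WTree.iterate_parent_mem hu n)]
  simp only [WTree.Desc, this]

lemma desc_new_iff (h : IsFork T ℓ C len T') {c : ℕ} (hc : c ∈ C) {v : ℕ} (hv : v ∈ T.V) :
    T'.Desc c v ↔ T.Desc ℓ v := by
  rw [← h.desc_iff h.leaf_mem]
  constructor
  · intro h1
    rcases h1.eq_or_parent with rfl | h1
    · exact absurd hv (h.not_mem_V hc)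
    · rwa [h.parent_new hc] at h1
  · intro h1
    have := WTree.Desc.parent T' c
    rw [h.parent_new hc] at this
    exact this.trans h1

lemma mem_leaves_iff (h : IsFork T ℓ C len T') (hC : C.Nonempty) {v : ℕ} :
    v ∈ T'.leaves ↔ (v ∈ T.leaves ∧ v ≠ ℓ) ∨ v ∈ C := by
  have hch : ∀ {u w : ℕ}, u ∈ T'.children w ↔ u ∈ T.children w ∨ (u ∈ C ∧ w = ℓ) := by
    intro u w
    rw [WTree.mem_children, WTree.mem_children, h.V_eq, h.root_eq, Finset.mem_union]
    constructor
    · rintro ⟨hu | hu, hr, hp⟩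
      · exact Or.inl ⟨hu, hr, (h.parent_eq hu).symm.trans hp⟩
      · exact Or.inr ⟨hu, hp.symm.trans (h.parent_new hu)⟩
    · rintro (⟨hu, hr, hp⟩ | ⟨hu, rfl⟩)
      · exact ⟨Or.inl hu, hr, (h.parent_eq hu).trans hp⟩
      · exact ⟨Or.inr hu, h.ne_root hu, h.parent_new hu⟩
  simp only [WTree.mem_leaves, Finset.eq_empty_iff_forall_notMem, hch, h.V_eq, Finset.mem_union,
    not_or, not_and]
  constructor
  · rintro ⟨hv | hv, h1⟩
    · obtain ⟨c, hc⟩ := hC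
      exact Or.inl ⟨⟨hv, fun u => (h1 u).1⟩, (h1 c).2 hc⟩
    · exact Or.inr hv
  · rintro (⟨⟨hv, h1⟩, hne⟩ | hv)
    · exact ⟨Or.inl hv, fun u => ⟨h1 u, fun _ => hne⟩⟩
    · refine ⟨Or.inr hv, fun u => ⟨fun hu => ?_, fun _ he => ?_⟩⟩
      · obtain ⟨huV, -, rfl⟩ := WTree.mem_children.1 hu
        exact h.not_mem_V hv (T.parent_mem u huV)
      · exact h.not_mem_V hv (he ▸ h.leaf_mem)

lemma new_mem_leaves (h : IsFork T ℓ C len T') {c : ℕ} (hc : c ∈ C) : c ∈ T'.leaves :=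
  (h.mem_leaves_iff ⟨c, hc⟩).2 (Or.inr hc)

open scoped Classical in
lemma mass_eq (h : IsFork T ℓ C len T') (z : ℕ → ℝ) {v : ℕ} (hv : v ∈ T.V) :
    T'.mass z v = T.mass z v + if T.Desc ℓ v then ∑ c ∈ C, z c else 0 := by
  have h1 : T'.descendants v = T.descendants v ∪ C.filter fun _ => T.Desc ℓ v := by
    ext w
    simp only [WTree.mem_descendants, h.V_eq, Finset.mem_union, Finset.mem_filter]
    constructor
    · rintro ⟨hw | hw, h1⟩
      · exact Or.inl ⟨hw, (h.desc_iff hw v).1 h1⟩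
      · exact Or.inr ⟨hw, (h.desc_new_iff hw hv).1 h1⟩
    · rintro (⟨hw, h1⟩ | ⟨hw, h1⟩)
      · exact ⟨Or.inl hw, (h.desc_iff hw v).2 h1⟩
      · exact ⟨Or.inr hw, (h.desc_new_iff hw hv).2 h1⟩
  rw [WTree.mass_eq, h1, Finset.sum_union, ← WTree.mass_eq]
  · split_ifs with h2 <;> simp [h2]
  · rw [Finset.disjoint_left]
    intro w hw hw'
    exact h.not_mem (WTree.mem_descendants.1 hw).1 (Finset.mem_filter.1 hw').1

end IsFork

/-- The weight `z` with the weight of `C` brought back to `ℓ`. -/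
def push (ℓ : ℕ) (C : Finset ℕ) (z : ℕ → ℝ) (v : ℕ) : ℝ :=
  if v = ℓ then ∑ c ∈ C, z c else if v ∈ C then 0 else z v

lemma push_self (ℓ : ℕ) (C : Finset ℕ) (z : ℕ → ℝ) : push ℓ C z ℓ = ∑ c ∈ C, z c := if_pos rfl

lemma push_of_ne {ℓ v : ℕ} {C : Finset ℕ} (z : ℕ → ℝ) (hv : v ≠ ℓ) (hC : v ∉ C) :
    push ℓ C z v = z v := by
  rw [push, if_neg hv, if_neg hC]

namespace IsFork

lemma mass_push (h : IsFork T ℓ C len T') {z : ℕ → ℝ} (hz : z ℓ = 0) {v : ℕ} (hv : v ∈ T.V) :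
    T'.mass z v = T.mass (push ℓ C z) v := by
  classical
  have h1 : ∀ w ∈ T.descendants v, push ℓ C z w = z w + if w = ℓ then ∑ c ∈ C, z c else 0 := by
    intro w hw
    by_cases hwl : w = ℓ
    · rw [hwl, push_self, hz, if_pos rfl, zero_add]
    · rw [push_of_ne z hwl (h.not_mem (WTree.mem_descendants.1 hw).1), if_neg hwl, add_zero]
  rw [h.mass_eq z hv, WTree.mass_eq T (push ℓ C z), Finset.sum_congr rfl h1,
    Finset.sum_add_distrib, Finset.sum_ite_eq', ← WTree.mass_eq]
  simp only [WTree.mem_descendants, h.leaf_mem, true_and]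

lemma erase_root (h : IsFork T ℓ C len T') : T'.V.erase T'.root = T.V.erase T.root ∪ C := by
  ext v
  simp only [h.V_eq, h.root_eq, Finset.mem_erase, Finset.mem_union]
  constructor
  · rintro ⟨h1, h2 | h2⟩
    · exact Or.inl ⟨h1, h2⟩
    · exact Or.inr h2
  · rintro (⟨h1, h2⟩ | h2)
    · exact ⟨h1, Or.inl h2⟩
    · exact ⟨h.ne_root h2, Or.inr h2⟩

lemma sum_erase_root (h : IsFork T ℓ C len T') (f : ℕ → ℝ) :
    ∑ u ∈ T'.V.erase T'.root, T'.d u * f u =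
      ∑ u ∈ T.V.erase T.root, T.d u * f u + len * ∑ c ∈ C, f c := by
  rw [h.erase_root, Finset.sum_union, Finset.mul_sum]
  · congr 1
    · refine Finset.sum_congr rfl fun u hu => ?_
      rw [h.d_eq (Finset.mem_of_mem_erase hu) (Finset.ne_of_mem_erase hu)]
    · exact Finset.sum_congr rfl fun c hc => by rw [h.d_new hc]
  · exact Finset.disjoint_of_subset_left (Finset.erase_subset _ _) h.disjoint

/-- The old edges see only the total below `ℓ`, that is `push`, so a fork merely adds the terms of
the new edges. `z ℓ = 0` is needed because `push` overwrites the value at `ℓ`. -/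
lemma Psi_eq (h : IsFork T ℓ C len T') (φ : ℝ → ℝ) {z : ℕ → ℝ} (hz : z ℓ = 0) :
    T'.Psi φ z = T.Psi φ (push ℓ C z) + len * ∑ c ∈ C, φ (z c) := by
  rw [WTree.Psi, h.sum_erase_root fun u => φ (T'.mass z u), WTree.Psi]
  congr 1
  · refine Finset.sum_congr rfl fun u hu => ?_
    rw [h.mass_push hz (Finset.mem_of_mem_erase hu)]
  · congr 1
    exact Finset.sum_congr rfl fun c hc => by rw [WTree.mass_leaf z (h.new_mem_leaves hc)]

lemma sum_leaves (h : IsFork T ℓ C len T') (hC : C.Nonempty) (z : ℕ → ℝ) :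
    ∑ v ∈ T'.leaves, z v = ∑ v ∈ T.leaves, push ℓ C z v := by
  have h1 : T'.leaves = T.leaves.erase ℓ ∪ C := by
    ext v
    rw [h.mem_leaves_iff hC, Finset.mem_union, Finset.mem_erase]
    tauto
  rw [h1, Finset.sum_union, ← Finset.add_sum_erase _ _ h.leaf, push_self, add_comm]
  · congr 1
    refine Finset.sum_congr rfl fun v hv => ?_
    obtain ⟨h2, h3⟩ := Finset.mem_erase.1 hv
    rw [push_of_ne z h2 (h.not_mem (WTree.mem_V_of_mem_leaves h3))]
  · rw [Finset.disjoint_left]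
    exact fun v hv => h.not_mem (WTree.mem_V_of_mem_leaves (Finset.mem_of_mem_erase hv))

lemma eq_zero_of_config (h : IsFork T ℓ C len T') (hC : C.Nonempty) {y : ℕ → ℝ}
    (hy : y ∈ fracConfigs k T') : y ℓ = 0 := by
  apply hy.1
  rw [h.mem_leaves_iff hC]
  rintro (⟨-, h1⟩ | h1)
  · exact h1 rfl
  · exact h.not_mem h.leaf_mem h1

lemma push_mem (h : IsFork T ℓ C len T') (hC : C.Nonempty) {y : ℕ → ℝ}
    (hy : y ∈ fracConfigs k T') : push ℓ C y ∈ fracConfigs k T := by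
  refine ⟨fun v hv => ?_, fun v hv => ?_, ?_⟩
  · have h1 : v ≠ ℓ := fun he => hv (he ▸ h.leaf)
    by_cases h2 : v ∈ C
    · rw [push, if_neg h1, if_pos h2]
    · rw [push_of_ne y h1 h2]
      apply hy.1
      rw [h.mem_leaves_iff hC]
      tauto
  · unfold push
    split_ifs
    · exact Finset.sum_nonneg fun c _ => fracConfigs_nonneg hy c
    · exact le_rfl
    · exact fracConfigs_nonneg hy v
  · rw [← h.sum_leaves hC, hy.2.2]

/-- `shift z ℓ c₀ (z ℓ)` sends the whole load of `ℓ` to one child. It serves as competitor both for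
the new optimum and, in discrete form, for the player's response. -/
lemma shift_new_eq_zero {c₀ : ℕ} (h : IsFork T ℓ C len T') (hc₀ : c₀ ∈ C) (z : ℕ → ℝ) :
    shift z ℓ c₀ (z ℓ) ℓ = 0 := by
  simp [shift, h.leaf_ne hc₀]

lemma push_shift_new {c₀ : ℕ} (h : IsFork T ℓ C len T') (hc₀ : c₀ ∈ C) {z : ℕ → ℝ}
    (hz : ∀ c ∈ C, z c = 0) : push ℓ C (shift z ℓ c₀ (z ℓ)) = z := by
  have hcl : ∀ c ∈ C, c ≠ ℓ := fun c hc => (h.leaf_ne hc).symm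
  funext v
  by_cases h1 : v = ℓ
  · subst h1
    rw [push_self, Finset.sum_eq_single_of_mem c₀ hc₀]
    · simp [shift, hz c₀ hc₀, hcl c₀ hc₀]
    · intro c hc hne
      simp [shift, hz c hc, hne, hcl c hc]
  · by_cases h2 : v ∈ C
    · rw [push, if_neg h1, if_pos h2, hz v h2]
    · have h3 : v ≠ c₀ := fun he => h2 (he ▸ hc₀)
      rw [push_of_ne _ h1 h2]
      simp [shift, h1, h3]

lemma Psi_shift_new {c₀ : ℕ} (h : IsFork T ℓ C len T') (hc₀ : c₀ ∈ C) {z : ℕ → ℝ}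
    (hz : ∀ c ∈ C, z c = 0) : T'.Psi (pot k) (shift z ℓ c₀ (z ℓ)) =
      T.Psi (pot k) z + len * pot k (z ℓ) := by
  have hcl : ∀ c ∈ C, c ≠ ℓ := fun c hc => (h.leaf_ne hc).symm
  rw [h.Psi_eq _ (h.shift_new_eq_zero hc₀ z), h.push_shift_new hc₀ hz,
    Finset.sum_eq_single_of_mem c₀ hc₀]
  · simp [shift, hz c₀ hc₀, hcl c₀ hc₀]
  · intro c hc hne
    simp [shift, hz c hc, hne, hcl c hc, pot_zero]

lemma shift_new_mem {c₀ : ℕ} (h : IsFork T ℓ C len T') (hc₀ : c₀ ∈ C) {y : ℕ → ℝ}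
    (hy : y ∈ fracConfigs k T) : shift y ℓ c₀ (y ℓ) ∈ fracConfigs k T' := by
  have hcl : ∀ c ∈ C, c ≠ ℓ := fun c hc => (h.leaf_ne hc).symm
  have hz : ∀ c ∈ C, y c = 0 := fun c hc =>
    hy.1 c fun hl => h.not_mem_V hc (WTree.mem_V_of_mem_leaves hl)
  refine ⟨fun v hv => ?_, fun v _ => ?_, ?_⟩
  · rw [h.mem_leaves_iff ⟨c₀, hc₀⟩] at hv
    by_cases h1 : v = ℓ
    · rw [h1, h.shift_new_eq_zero hc₀]
    · have h2 : v ≠ c₀ := fun he => hv (Or.inr (he ▸ hc₀))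
      have h3 : v ∉ T.leaves := by tauto
      simp [shift, h1, h2, hy.1 v h3]
  · by_cases h1 : v = ℓ
    · rw [h1, h.shift_new_eq_zero hc₀]
    · have := fracConfigs_nonneg hy v
      have := fracConfigs_nonneg hy ℓ
      unfold shift
      split_ifs <;> linarith
  · rw [h.sum_leaves ⟨c₀, hc₀⟩, h.push_shift_new hc₀ hz, hy.2.2]

lemma transfer_new_mem {c₀ : ℕ} (h : IsFork T ℓ C len T') (hc₀ : c₀ ∈ C) {x : ℕ → ℕ}
    (hx : x ∈ discreteConfigs k T) : transfer x ℓ c₀ (x ℓ) ∈ discreteConfigs k T' := by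
  have h1 := h.shift_new_mem hc₀ (toFrac_mem_fracConfigs hx)
  rw [← toFrac_transfer (h.leaf_ne hc₀) le_rfl] at h1
  exact ⟨fun v hv => by exact_mod_cast h1.1 v hv, by exact_mod_cast h1.2.2⟩

lemma OT_shift_new {c₀ : ℕ} (h : IsFork T ℓ C len T') (hc₀ : c₀ ∈ C) {z : ℕ → ℝ}
    (hz : 0 ≤ z ℓ) : T'.OT z (shift z ℓ c₀ (z ℓ)) = len * z ℓ := by
  have hV : ∀ {v}, v ∈ T'.V ↔ v ∈ T.V ∨ v ∈ C := by
    intro v; rw [h.V_eq, Finset.mem_union]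
  rw [WTree.OT_shift z (hV.2 (Or.inl h.leaf_mem)) (hV.2 (Or.inr hc₀)) hz]
  have h1 : T'.anc ℓ \ T'.anc c₀ = ∅ := by
    rw [Finset.sdiff_eq_empty_iff_subset]
    intro u hu
    rw [WTree.mem_anc] at hu ⊢
    refine ⟨hu.1, hu.2.1, WTree.Desc.trans ?_ hu.2.2⟩
    rw [← h.parent_new hc₀]
    exact WTree.Desc.parent T' c₀
  have h2 : T'.anc c₀ \ T'.anc ℓ = {c₀} := by
    ext u
    rw [Finset.mem_sdiff, WTree.mem_anc, WTree.mem_anc, Finset.mem_singleton]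
    constructor
    · rintro ⟨⟨h3, h4, h5⟩, h6⟩
      rcases h5.eq_or_parent with h7 | h7
      · exact h7
      · rw [h.parent_new hc₀] at h7
        exact absurd ⟨h3, h4, h7⟩ h6
    · rintro rfl
      refine ⟨⟨h.root_eq ▸ h.ne_root hc₀, hV.2 (Or.inr hc₀), WTree.Desc.refl T' u⟩, fun h3 => ?_⟩
      exact h.not_mem (((h.desc_iff h.leaf_mem u).1 h3.2.2).mem h.leaf_mem) hc₀
  rw [h1, h2]
  simp only [WTree.len, Finset.sum_empty, Finset.sum_singleton, h.d_new hc₀]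
  ring

/-- The optimal configuration gives the same weight to all the children of a fork. -/
lemma le_of_isOptimalFrac (h : IsFork T ℓ C len T') (hlen : 0 < len) {y' : ℕ → ℝ}
    (hy' : IsOptimalFrac (pot k) k T' y') {c c' : ℕ} (hc : c ∈ C) (hc' : c' ∈ C) :
    y' c' ≤ y' c := by
  by_contra! hlt
  have hne : c' ≠ c := by rintro rfl; exact lt_irrefl _ hlt
  have h0 := fracConfigs_nonneg hy'.1 c
  have hz := h.eq_zero_of_config ⟨c, hc⟩ hy'.1
  -- Averaging the two children leaves all old masses unchanged and strictly lowers the convex terms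
  -- of the new edges.
  set t := (y' c' - y' c) / 2 with ht
  have hmem := shift_mem_fracConfigs hy'.1 (h.new_mem_leaves hc') (h.new_mem_leaves hc)
    (t := t) (by linarith) (by linarith)
  have h1 : T'.Psi (pot k) y' ≤ T'.Psi (pot k) (shift y' c' c t) := hy'.2 hmem
  have hsum : ∀ s : ℝ, ∑ v ∈ C, shift y' c' c s v = ∑ v ∈ C, y' v := by
    intro s
    simp only [shift, Finset.sum_add_distrib, ← Finset.mul_sum, Finset.sum_sub_distrib,
      Finset.sum_ite_eq', hc, hc', if_true]
    ring
  have hpush : push ℓ C (shift y' c' c t) = push ℓ C y' := by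
    funext v
    unfold push
    split_ifs with h2 h3
    · exact hsum t
    · rfl
    · have h4 : v ≠ c := fun he => h3 (he ▸ hc)
      have h5 : v ≠ c' := fun he => h3 (he ▸ hc')
      simp [shift, h4, h5]
  rw [h.Psi_eq _ hz, h.Psi_eq _ (h.eq_zero_of_config ⟨c, hc⟩ hmem), hpush] at h1
  have h2 : ∑ v ∈ C, pot k (y' v) ≤ ∑ v ∈ C, pot k (shift y' c' c t v) :=
    le_of_mul_le_mul_left ((add_le_add_iff_left _).1 h1) hlen
  have hc'e : c' ∈ C.erase c := Finset.mem_erase.2 ⟨hne, hc'⟩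
  rw [← Finset.add_sum_erase _ _ hc, ← Finset.add_sum_erase _ _ hc'e,
    ← Finset.add_sum_erase C (fun v => pot k (shift y' c' c t v)) hc,
    ← Finset.add_sum_erase _ (fun v => pot k (shift y' c' c t v)) hc'e] at h2
  have h3 : ∑ v ∈ (C.erase c).erase c', pot k (shift y' c' c t v) =
      ∑ v ∈ (C.erase c).erase c', pot k (y' v) := by
    refine Finset.sum_congr rfl fun v hv => ?_
    rw [Finset.mem_erase, Finset.mem_erase] at hv
    simp [shift, hv.1, hv.2.1]
  rw [h3] at h2
  simp only [shift, hne, hne.symm, if_true, if_false, pot] at h2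
  have : y' c' = y' c + 2 * t := by rw [ht]; ring
  rw [this] at h2
  have ht0 : 0 < t := by linarith
  nlinarith [mul_pos ht0 ht0]

/-- A fork does not decrease the optimal weight of the other leaves. -/
lemma le_of_other_leaf (h : IsFork T ℓ C len T') (hC : C.Nonempty) (hlen : 0 < len)
    {y y' : ℕ → ℝ} (hy : IsOptimalFrac (pot k) k T y) (hy' : IsOptimalFrac (pot k) k T' y')
    {ℓ₁ : ℕ} (hℓ₁ : ℓ₁ ∈ T.leaves) (hne₁ : ℓ₁ ≠ ℓ) : y ℓ₁ ≤ y' ℓ₁ := by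
  have hz := h.eq_zero_of_config hC hy'.1
  have hC1 : ∀ {v}, v ∈ T.leaves → v ∉ C := fun hv => h.not_mem (WTree.mem_V_of_mem_leaves hv)
  have hpm := h.push_mem hC hy'.1
  rw [← push_of_ne y' hne₁ (hC1 hℓ₁)]
  refine le_of_price_le hy hpm hℓ₁ fun ℓ' hℓ' hne hpos => ?_
  have hl1 : ℓ₁ ∈ T'.leaves := (h.mem_leaves_iff hC).2 (Or.inl ⟨hℓ₁, hne₁⟩)
  suffices hp : WTree.price k T (push ℓ C y') ℓ' ≤ WTree.price k T (push ℓ C y') ℓ₁ by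
    rw [← sub_nonneg, WTree.price_sub_price] at hp
    linarith
  -- A transfer from `ℓ'` to `ℓ₁` in `T` is lifted to `T'`, starting from a loaded child when `ℓ' =
  -- ℓ`. The lift does not raise the potential of the new edges, so optimality in `T'` shows that
  -- the transfer does not lower `Ψ` in `T`.
  obtain ⟨s, hs, hs0, hpush⟩ : ∃ s ∈ T'.leaves, 0 < y' s ∧ ∀ t, 0 ≤ t → t ≤ y' s →
      push ℓ C (shift y' s ℓ₁ t) = shift (push ℓ C y') ℓ' ℓ₁ t ∧
      ∑ c ∈ C, pot k (shift y' s ℓ₁ t c) ≤ ∑ c ∈ C, pot k (y' c) := by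
    by_cases hl : ℓ' = ℓ
    · subst hl
      rw [push_self] at hpos
      obtain ⟨s, hs, hs0⟩ : ∃ s ∈ C, 0 < y' s := by
        by_contra! hcon
        exact absurd (Finset.sum_nonpos hcon) (not_le.2 hpos)
      have hnl : ∀ c ∈ C, c ≠ ℓ₁ := fun c hc he => hC1 hℓ₁ (he ▸ hc)
      refine ⟨s, h.new_mem_leaves hs, hs0, fun t ht hts => ⟨?_, ?_⟩⟩
      · funext v
        by_cases h1 : v = ℓ'
        · subst h1
          simp only [push_self, shift, Finset.sum_add_distrib, ← Finset.mul_sum,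
            Finset.sum_sub_distrib, Finset.sum_ite_eq', hs, hC1 hℓ₁, if_true, if_false, hne]
        · by_cases h2 : v ∈ C
          · simp [push, shift, h1, h2, hnl v h2]
          · have h3 : v ≠ s := fun he => h2 (he ▸ hs)
            simp [push, shift, h1, h2, h3]
      · refine Finset.sum_le_sum fun c hc => ?_
        have h0 := fracConfigs_nonneg hy'.1 c
        simp only [shift, hnl c hc, if_false]
        split_ifs with h1
        · subst h1
          exact pot_le_pot k (by linarith) (by linarith)
        · simp
    · rw [push_of_ne y' hl (hC1 hℓ')] at hpos
      have hsh : ∀ t, ∀ c ∈ C, shift y' ℓ' ℓ₁ t c = y' c := by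
        intro t c hc
        have h1 : c ≠ ℓ' := fun he => hC1 hℓ' (he ▸ hc)
        have h2 : c ≠ ℓ₁ := fun he => hC1 hℓ₁ (he ▸ hc)
        simp [shift, h1, h2]
      refine ⟨ℓ', (h.mem_leaves_iff hC).2 (Or.inl ⟨hℓ', hl⟩), hpos, fun t _ _ => ⟨?_, ?_⟩⟩
      · funext v
        unfold push
        split_ifs with h1 h2
        · subst h1
          rw [Finset.sum_congr rfl (hsh t)]
          simp [shift, hne₁.symm, Ne.symm hl]
        · have h3 : v ≠ ℓ' := fun he => hC1 hℓ' (he ▸ h2)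
          have h4 : v ≠ ℓ₁ := fun he => hC1 hℓ₁ (he ▸ h2)
          simp [shift, h1, h2, h3, h4]
        · simp [shift, h1, h2]
      · exact (Finset.sum_congr rfl fun c hc => by rw [hsh t c hc]).le
  refine WTree.price_le_price (WTree.mem_V_of_mem_leaves hℓ') (WTree.mem_V_of_mem_leaves hℓ₁) hs0
    fun t ht hts => ?_
  obtain ⟨h1, h2⟩ := hpush t ht.le hts
  have hmem := shift_mem_fracConfigs hy'.1 hs hl1 ht.le hts
  have h3 : T'.Psi (pot k) y' ≤ T'.Psi (pot k) (shift y' s ℓ₁ t) := hy'.2 hmem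
  rw [h.Psi_eq _ hz, h.Psi_eq _ (h.eq_zero_of_config hC hmem), h1] at h3
  have := mul_le_mul_of_nonneg_left h2 hlen.le
  linarith

end IsFork

lemma Invariant.fork {x x' : ℕ → ℕ} {c : ℝ} {m : ℕ} (h : Invariant k T x c)
    (hstable : Stable (pot k) k T x) (hm : 2 ≤ m) (hmx : m + 1 ≤ x ℓ) (hCm : C.card = m)
    (hf : IsFork T ℓ C len T') (hlen : 0 < len) (hlen' : ℓ ≠ T.root → len * (20 * k ^ 2) ≤ T.d ℓ)
    (hresp : IsResponse (pot k) k T' x T' x') :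
    Invariant k T' x' (c + T'.OT (toFrac x) (toFrac x')) := by
  refine ⟨hresp.1, fun y' hy' => ?_⟩
  obtain ⟨y, hy⟩ := exists_isOptimalFrac k T
  obtain ⟨h1, h2⟩ := h.2 y hy
  have hC : C.Nonempty := by rw [← Finset.card_pos]; omega
  obtain ⟨c₀, hc₀⟩ := hC
  have hz := hf.eq_zero_of_config ⟨c₀, hc₀⟩ hy'.1
  have hpm := hf.push_mem ⟨c₀, hc₀⟩ hy'.1
  have hxk := le_of_mem_discreteConfigs h.1 ℓ
  have hk3 : (3 : ℝ) ≤ k := by exact_mod_cast (by omega : 3 ≤ k)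
  have hm2 : (2 : ℝ) ≤ m := by exact_mod_cast hm
  have hmx' : (m : ℝ) + 1 ≤ x ℓ := by exact_mod_cast hmx
  have hnew : ∀ v ∈ C, v ∉ T.leaves := fun v hv hl =>
    hf.not_mem_V hv (WTree.mem_V_of_mem_leaves hl)
  have hPsi := hf.Psi_eq (pot k) hz
  set S := ∑ v ∈ C, y' v with hS
  have hpS : push ℓ C y' ℓ = S := push_self ℓ C y'
  have hyl := fracConfigs_nonneg hy.1 ℓ
  have hpot : 20 * k * S ≤ ∑ v ∈ C, pot k (y' v) := by
    rw [hS, Finset.mul_sum]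
    exact Finset.sum_le_sum fun v _ => linear_le_pot k (y' v)
  -- Comparing `y'` with the competitor through strong convexity on the edge above `ℓ` gives `5 d (S
  -- - y ℓ)² ≤ 25 k² len ≤ (5 / 4) d`. If `ℓ` is the root, no weight can leave it.
  have hSk : y ℓ - 1 / 2 ≤ S := by
    by_cases hr : ℓ = T.root
    · have h3 := mass_root_of_mem_fracConfigs hpm
      rw [← hr, WTree.mass_leaf _ hf.leaf, hpS] at h3
      have h4 := le_of_mem_fracConfigs hy.1 ℓ
      linarith
    · have h3 := hy.add_sq_le hpm hf.leaf_mem hr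
      rw [WTree.mass_leaf _ hf.leaf, WTree.mass_leaf _ hf.leaf, hpS] at h3
      have h4 : T'.Psi (pot k) y' ≤ _ := hy'.2 (hf.shift_new_mem hc₀ hy.1)
      rw [hf.Psi_shift_new hc₀ fun v hv => hy.1.1 v (hnew v hv), hPsi] at h4
      have h5 : 0 ≤ ∑ v ∈ C, pot k (y' v) :=
        Finset.sum_nonneg fun v _ => pot_nonneg k (fracConfigs_nonneg hy'.1 v)
      have h6 : pot k (y ℓ) ≤ 25 * k ^ 2 := by
        have h7 := le_of_mem_fracConfigs hy.1 ℓ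
        refine (pot_le_linear k hyl h7).trans ?_
        nlinarith
      have h7 := T.d_pos ℓ hf.leaf_mem hr
      have h8 := hlen' hr
      have h9 := mul_le_mul_of_nonneg_left h6 hlen.le
      have h10 := mul_nonneg hlen.le h5
      have h11 : T.d ℓ * (S - y ℓ) ^ 2 ≤ T.d ℓ * (1 / 4) := by nlinarith
      have h12 := le_of_mul_le_mul_left h11 h7
      nlinarith
  have hxy : (x ℓ : ℝ) ≤ 6 / 5 + 11 / 10 * y ℓ := by
    have h3 := hstable.weaklyStable.le_add (by omega) h.1 hy hf.leaf
    have h4 : 3 / (10 * (k : ℝ)) ≤ 1 / 10 := by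
      rw [div_le_div_iff₀ (by positivity) (by norm_num)]; linarith
    nlinarith
  refine ⟨fun v hv => ?_, ?_⟩
  · rcases (hf.mem_leaves_iff ⟨c₀, hc₀⟩).1 hv with ⟨hv1, hv2⟩ | hv1
    · exact (h1 v hv1).trans (hf.le_of_other_leaf ⟨c₀, hc₀⟩ hlen hy hy' hv1 hv2)
    · have h3 : S ≤ m * y' v := by
        rw [hS, ← hCm, ← nsmul_eq_mul]
        exact Finset.sum_le_card_nsmul _ _ _ fun w hw => hf.le_of_isOptimalFrac hlen hy' hv1 hw
      by_contra! hlt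
      nlinarith
  · have h3 : T'.Psi (pot k) (toFrac x') + T'.OT (toFrac x) (toFrac x') ≤
        T'.Psi (pot k) (toFrac (transfer x ℓ c₀ (x ℓ))) +
          T'.OT (toFrac x) (toFrac (transfer x ℓ c₀ (x ℓ))) :=
      hresp.2 (hf.transfer_new_mem hc₀ h.1)
    rw [toFrac_transfer (hf.leaf_ne hc₀) le_rfl,
      hf.OT_shift_new (z := toFrac x) hc₀ (Nat.cast_nonneg _), hf.Psi_shift_new (z := toFrac x) hc₀
      fun v hv => (toFrac_mem_fracConfigs h.1).1 v (hnew v hv)] at h3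
    have h4 := pot_le_linear k (Nat.cast_nonneg (x ℓ)) (Nat.cast_le.2 hxk)
    have h5 : T.Psi (pot k) y ≤ T.Psi (pot k) (push ℓ C y') := hy.2 hpm
    have h6 : pot k (x ℓ) + x ℓ ≤ 48 * ∑ v ∈ C, pot k (y' v) := by
      have h7 : 37 / 100 * (x ℓ : ℝ) ≤ S := by linarith
      have h8 : (k : ℝ) * (37 / 100 * x ℓ) ≤ k * S := by gcongr
      nlinarith
    have h7 := mul_le_mul_of_nonneg_left h6 hlen.le
    rw [hPsi]
    linarith

end Fork

/-! ### Deletions -/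

section Kill

variable {k : ℕ} {T T' : WTree} {ℓ : ℕ}

namespace IsKill

lemma leaf (h : IsKill T ℓ T') : ℓ ∈ T.leaves := h.1

lemma leaf_mem (h : IsKill T ℓ T') : ℓ ∈ T.V := WTree.mem_V_of_mem_leaves h.leaf

lemma root_eq (h : IsKill T ℓ T') : T'.root = T.root := h.2.2.1

lemma ne_root (h : IsKill T ℓ T') : ℓ ≠ T.root := by
  intro he
  obtain ⟨ℓ', hℓ', hne⟩ := h.2.1
  have hV := WTree.mem_V_of_mem_leaves hℓ'
  exact hne (WTree.eq_of_desc_leaf hV h.leaf (he ▸ WTree.desc_root hV))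

lemma mem_children (h : IsKill T ℓ T') : ℓ ∈ T.children (T.parent ℓ) :=
  WTree.mem_children.2 ⟨h.leaf_mem, h.ne_root, rfl⟩

/-- Below the root this is the simplicity of the tree; at the root it comes from the existence of
another leaf. -/
lemma exists_sibling (h : IsKill T ℓ T') : ∃ c ∈ T.children (T.parent ℓ), c ≠ ℓ := by
  by_cases hp : T.parent ℓ = T.root
  · obtain ⟨ℓ', hℓ', hne⟩ := h.2.1
    have hV := WTree.mem_V_of_mem_leaves hℓ'
    obtain ⟨c, hc, hd⟩ := WTree.exists_child_of_desc hV (WTree.desc_root hV) (by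
      rintro rfl
      exact WTree.parent_ne_leaf hℓ' h.leaf_mem h.ne_root hp)
    refine ⟨c, hp ▸ hc, ?_⟩
    rintro rfl
    exact hne (WTree.eq_of_desc_leaf hV h.leaf hd)
  · by_contra! hcon
    apply T.simple _ (T.parent_mem ℓ h.leaf_mem) hp
    rw [Finset.card_eq_one]
    exact ⟨ℓ, Finset.eq_singleton_iff_unique_mem.2 ⟨h.mem_children, hcon⟩⟩

lemma mem_V (h : IsKill T ℓ T') {v : ℕ} (hv : v ∈ T'.V) : v ∈ T.V ∧ v ≠ ℓ := by
  rcases h.2.2.2 with ⟨-, hV, -⟩ | ⟨-, u, -, hV, -⟩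
  · rw [hV, Finset.mem_erase] at hv
    exact hv.symm
  · rw [hV, Finset.mem_erase, Finset.mem_erase] at hv
    exact ⟨hv.2.2, hv.2.1⟩

lemma mem_V_of_ne (h : IsKill T ℓ T') {v : ℕ} (hv : v ∈ T.V) (h1 : v ≠ ℓ)
    (h2 : v ≠ T.parent ℓ) : v ∈ T'.V := by
  rcases h.2.2.2 with ⟨-, hV, -⟩ | ⟨-, u, -, hV, -⟩
  · rw [hV, Finset.mem_erase]
    exact ⟨h1, hv⟩
  · rw [hV, Finset.mem_erase, Finset.mem_erase]
    exact ⟨h2, h1, hv⟩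

lemma parent_cases (h : IsKill T ℓ T') {v : ℕ} (hv : v ∈ T'.V) (hr : v ≠ T.root) :
    T'.parent v = T.parent v ∨
      (T.parent v ∉ T'.V ∧ T'.parent v = T.parent (T.parent v)) := by
  rcases h.2.2.2 with ⟨-, -, h1⟩ | ⟨-, u, hu, hV, h1, -, h2⟩
  · exact Or.inl (h1 v hv hr).1
  · by_cases hvu : v = u
    · right
      have : u ∈ (T.children (T.parent ℓ)).erase ℓ := by rw [hu]; simp
      have hp := (WTree.mem_children.1 (Finset.mem_of_mem_erase this)).2.2
      rw [hvu, hp, hV]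
      exact ⟨by simp, h1⟩
    · exact Or.inl (h2 v hv hr hvu).1

lemma desc_iff (h : IsKill T ℓ T') {v w : ℕ} (hw : w ∈ T'.V) (hv : v ∈ T'.V) :
    T'.Desc w v ↔ T.Desc w v := by
  constructor
  · rintro ⟨n, hn⟩
    induction n generalizing w with
    | zero => exact ⟨0, hn⟩
    | succ n ih =>
      have h1 := ih (T'.parent_mem w hw) hn
      by_cases hr : w = T.root
      · have h2 : T'.parent w = w := by
          rw [hr, ← h.root_eq, T'.parent_root]
        rwa [h2] at h1
      · rcases h.parent_cases hw hr with h2 | ⟨-, h2⟩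
        · rw [h2] at h1
          exact (WTree.Desc.parent T w).trans h1
        · rw [h2] at h1
          exact (WTree.Desc.parent T w).trans ((WTree.Desc.parent T _).trans h1)
  · rintro ⟨n, hn⟩
    -- Strong induction, because one parent step in `T'` may skip the suppressed vertex and amount
    -- to two steps in `T`.
    induction n using Nat.strong_induction_on generalizing w with
    | _ n ih =>
      by_cases hr : w = T.root
      · rw [hr, WTree.iterate_parent_root] at hn
        rw [← hn, hr]
        exact WTree.Desc.refl T' _
      · cases n with
        | zero => exact ⟨0, hn⟩
        | succ n =>
          have hpw := T'.parent_mem w hw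
          refine (WTree.Desc.parent T' w).trans ?_
          rcases h.parent_cases hw hr with h2 | ⟨h3, h2⟩
          · rw [h2] at hpw ⊢
            exact ih n (Nat.lt_succ_self n) hpw hn
          · cases n with
            | zero =>
              have hn' : T.parent w = v := hn
              exact absurd (hn' ▸ hv) h3
            | succ n =>
              rw [h2] at hpw ⊢
              exact ih n (by omega) hpw hn

lemma leaves_ne_parent (h : IsKill T ℓ T') {v : ℕ} (hv : v ∈ T.leaves) : v ≠ T.parent ℓ :=
  fun he => WTree.parent_ne_leaf hv h.leaf_mem h.ne_root he.symm

/-- Being a leaf is expressed by descendants, which `desc_iff` transports. The parent of `ℓ` does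
not become a leaf because `ℓ` has a sibling. -/
lemma mem_leaves_iff (h : IsKill T ℓ T') {v : ℕ} : v ∈ T'.leaves ↔ v ∈ T.leaves ∧ v ≠ ℓ := by
  have key : ∀ {S : WTree} {v : ℕ}, v ∈ S.V → (∀ w ∈ S.V, S.Desc w v → w = v) →
      v ∈ S.leaves := by
    intro S v hv hS
    by_contra hl
    obtain ⟨c, hc⟩ := WTree.exists_child_of_not_leaf hv hl
    have := hS c (WTree.mem_children.1 hc).1 (WTree.desc_of_mem_children hc)
    subst this
    exact WTree.not_desc_child hc (WTree.Desc.refl S c)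
  constructor
  · intro hl
    have hv' := WTree.mem_V_of_mem_leaves hl
    obtain ⟨hv, hne⟩ := h.mem_V hv'
    refine ⟨key hv fun w hw hd => ?_, hne⟩
    have hlow : ∀ u ∈ T'.V, T.Desc u v → u = v := fun u hu hd =>
      WTree.eq_of_desc_leaf hu hl ((h.desc_iff hu hv').2 hd)
    obtain ⟨c, hc, hcl⟩ := h.exists_sibling
    have hpar : ¬ T.Desc (T.parent ℓ) v := by
      intro hd
      have hcV : c ∈ T'.V := h.mem_V_of_ne (WTree.mem_children.1 hc).1 hcl (by
        rintro rfl
        exact WTree.not_desc_child hc (WTree.Desc.refl T _))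
      have := hlow c hcV ((WTree.desc_of_mem_children hc).trans hd)
      subst this
      exact WTree.not_desc_child hc hd
    by_cases hwl : w = ℓ
    · subst hwl
      rcases hd.eq_or_parent with h1 | h1
      · exact h1.symm
      · exact absurd h1 hpar
    · by_cases hwp : w = T.parent ℓ
      · exact absurd (hwp ▸ hd) hpar
      · exact hlow w (h.mem_V_of_ne hw hwl hwp) hd
  · rintro ⟨hl, hne⟩
    have hv' := h.mem_V_of_ne (WTree.mem_V_of_mem_leaves hl) hne (h.leaves_ne_parent hl)
    exact key hv' fun w hw hd =>
      WTree.eq_of_desc_leaf (h.mem_V hw).1 hl ((h.desc_iff hw hv').1 hd)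

lemma mass_eq (h : IsKill T ℓ T') {z : ℕ → ℝ} (hz : ∀ v, v ∉ T'.leaves → z v = 0) {v : ℕ}
    (hv : v ∈ T'.V) : T'.mass z v = T.mass z v := by
  rw [WTree.mass_eq, WTree.mass_eq]
  refine Finset.sum_subset (fun w hw => ?_) fun w hw hw' => hz w fun hl => hw' ?_
  · obtain ⟨h1, h2⟩ := WTree.mem_descendants.1 hw
    exact WTree.mem_descendants.2 ⟨(h.mem_V h1).1, (h.desc_iff h1 hv).1 h2⟩
  · have h1 := WTree.mem_V_of_mem_leaves hl
    exact WTree.mem_descendants.2 ⟨h1, (h.desc_iff h1 hv).2 (WTree.mem_descendants.1 hw).2⟩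

/-- With no weight at `ℓ`, the suppressed vertex has the mass of its remaining child, so merging the
two edges changes nothing. Hence the optimum of `T'` is the optimum of `T` under the constraint of
weight `0` at `ℓ`. -/
lemma Psi_eq (h : IsKill T ℓ T') {z : ℕ → ℝ} (hz : ∀ v, v ∉ T'.leaves → z v = 0) :
    T'.Psi (pot k) z = T.Psi (pot k) z := by
  have hzl : z ℓ = 0 := hz ℓ fun hl => (h.mem_leaves_iff.1 hl).2 rfl
  have hℓe : ℓ ∈ T.V.erase T.root := Finset.mem_erase.2 ⟨h.ne_root, h.leaf_mem⟩
  have hml := WTree.mass_leaf z h.leaf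
  rw [hzl] at hml
  unfold WTree.Psi
  rw [← Finset.add_sum_erase _ _ hℓe, hml, pot_zero, mul_zero, zero_add, h.root_eq]
  rcases h.2.2.2 with ⟨-, hV, hd⟩ | ⟨hp, u, hu, hV, -, hdu, hd⟩
  · rw [Finset.erase_right_comm, ← hV]
    refine Finset.sum_congr rfl fun v hv => ?_
    obtain ⟨h1, h2⟩ := Finset.mem_erase.1 hv
    rw [(hd v h2 h1).2, h.mass_eq hz h2]
  · have hue : u ∈ (T.children (T.parent ℓ)).erase ℓ := by rw [hu]; simp
    obtain ⟨hul, huc⟩ := Finset.mem_erase.1 hue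
    obtain ⟨huV, hur, hup⟩ := WTree.mem_children.1 huc
    have hunp : u ≠ T.parent ℓ := by
      rw [← hup]
      exact (WTree.parent_ne huV hur).symm
    have huV' := h.mem_V_of_ne huV hul hunp
    have hpV := T.parent_mem ℓ h.leaf_mem
    have hpe : T.parent ℓ ∈ (T.V.erase T.root).erase ℓ :=
      Finset.mem_erase.2 ⟨WTree.parent_ne h.leaf_mem h.ne_root, Finset.mem_erase.2 ⟨hp, hpV⟩⟩
    have hmp : T.mass z (T.parent ℓ) = T.mass z u := by
      have h1 : z (T.parent ℓ) = 0 :=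
        hz _ fun hl => h.leaves_ne_parent (h.mem_leaves_iff.1 hl).1 rfl
      rw [WTree.mass_eq_add_sum_children z hpV, h1, ← Finset.add_sum_erase _ _ h.mem_children, hu,
        hml]
      simp
    have hset : ((T.V.erase T.root).erase ℓ).erase (T.parent ℓ) = T'.V.erase T.root := by
      rw [hV, Finset.erase_right_comm (a := T.root), Finset.erase_right_comm (a := T.root)]
    have hu' : u ∈ T'.V.erase T.root := Finset.mem_erase.2 ⟨hur, huV'⟩
    rw [← Finset.add_sum_erase _ _ hpe, hset, ← Finset.add_sum_erase _ _ hu',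
      ← Finset.add_sum_erase _ _ hu', hmp, hdu, h.mass_eq hz huV', ← add_assoc, ← add_mul]
    congr 1
    refine Finset.sum_congr rfl fun v hv => ?_
    obtain ⟨h1, h2⟩ := Finset.mem_erase.1 hv
    obtain ⟨h3, h4⟩ := Finset.mem_erase.1 h2
    rw [(hd v h4 h3 h1).2, h.mass_eq hz h4]

lemma mem_fracConfigs_iff (h : IsKill T ℓ T') {y : ℕ → ℝ} :
    y ∈ fracConfigs k T' ↔ y ∈ fracConfigs k T ∧ y ℓ = 0 := by
  have hl : T'.leaves = T.leaves.erase ℓ := by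
    ext v
    rw [h.mem_leaves_iff, Finset.mem_erase, and_comm]
  have hsum : y ℓ = 0 → ∑ v ∈ T'.leaves, y v = ∑ v ∈ T.leaves, y v := fun h0 => by
    rw [hl, ← Finset.add_sum_erase _ _ h.leaf, h0, zero_add]
  constructor
  · intro hy
    have h0 : y ℓ = 0 := hy.1 ℓ fun hl => (h.mem_leaves_iff.1 hl).2 rfl
    exact ⟨⟨fun v hv => hy.1 v fun hv' => hv (h.mem_leaves_iff.1 hv').1,
      fun v _ => fracConfigs_nonneg hy v, by rw [← hsum h0, hy.2.2]⟩, h0⟩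
  · rintro ⟨hy, h0⟩
    refine ⟨fun v hv => ?_, fun v _ => fracConfigs_nonneg hy v, by rw [hsum h0, hy.2.2]⟩
    by_cases hvl : v = ℓ
    · rw [hvl, h0]
    · exact hy.1 v fun hv' => hv (h.mem_leaves_iff.2 ⟨hv', hvl⟩)

lemma mem_discreteConfigs (h : IsKill T ℓ T') {x : ℕ → ℕ} (hx : x ∈ discreteConfigs k T)
    (h0 : x ℓ = 0) : x ∈ discreteConfigs k T' := by
  have h1 := h.mem_fracConfigs_iff.2
    ⟨toFrac_mem_fracConfigs hx, show toFrac x ℓ = 0 by simp [toFrac, h0]⟩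
  exact ⟨fun v hv => by exact_mod_cast h1.1 v hv, by exact_mod_cast h1.2.2⟩

/-- A deletion does not decrease the optimal weight of the other leaves. -/
lemma le_of_other_leaf (h : IsKill T ℓ T') {y y' : ℕ → ℝ} (hy : IsOptimalFrac (pot k) k T y)
    (hy' : IsOptimalFrac (pot k) k T' y') {ℓ₁ : ℕ} (hℓ₁ : ℓ₁ ∈ T'.leaves) : y ℓ₁ ≤ y' ℓ₁ := by
  obtain ⟨hm, h0⟩ := h.mem_fracConfigs_iff.1 hy'.1
  obtain ⟨hl1, -⟩ := h.mem_leaves_iff.1 hℓ₁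
  refine le_of_price_le hy hm hl1 fun ℓ' hℓ' _ hpos => ?_
  have hl' : ℓ' ∈ T'.leaves := by
    refine h.mem_leaves_iff.2 ⟨hℓ', ?_⟩
    rintro rfl
    exact hpos.ne' h0
  have hp : WTree.price k T y' ℓ' ≤ WTree.price k T y' ℓ₁ := by
    refine WTree.price_le_price (WTree.mem_V_of_mem_leaves hℓ') (WTree.mem_V_of_mem_leaves hl1)
      hpos fun t ht hty => ?_
    have hmem := shift_mem_fracConfigs hy'.1 hl' hℓ₁ ht.le hty
    rw [← h.Psi_eq hy'.1.1, ← h.Psi_eq hmem.1]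
    exact hy'.2 hmem
  rw [← sub_nonneg, WTree.price_sub_price] at hp
  linarith

lemma anc_sdiff (h : IsKill T ℓ T') {ℓ' : ℕ} (hℓ' : ℓ' ∈ T.leaves) (hne : ℓ' ≠ ℓ)
    (hd : T.Desc ℓ' (T.parent ℓ)) : T.anc ℓ \ T.anc ℓ' = {ℓ} := by
  ext u
  rw [Finset.mem_sdiff, WTree.mem_anc, WTree.mem_anc, Finset.mem_singleton]
  constructor
  · rintro ⟨⟨h1, h2, h3⟩, h4⟩
    rcases h3.eq_or_parent with h5 | h5
    · exact h5
    · exact absurd ⟨h1, h2, hd.trans h5⟩ h4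
  · rintro rfl
    exact ⟨⟨h.ne_root, h.leaf_mem, WTree.Desc.refl T u⟩, fun h1 => hne
      (WTree.eq_of_desc_leaf (WTree.mem_V_of_mem_leaves hℓ') h.leaf h1.2.2)⟩

lemma exists_leaf (h : IsKill T ℓ T') : ∃ ℓ' ∈ T.leaves, ℓ' ≠ ℓ ∧ T.Desc ℓ' (T.parent ℓ) := by
  obtain ⟨c, hc, hcl⟩ := h.exists_sibling
  obtain ⟨ℓ', hℓ', hd⟩ := WTree.exists_leaf_desc (WTree.mem_children.1 hc).1
  refine ⟨ℓ', hℓ', ?_, hd.trans (WTree.desc_of_mem_children hc)⟩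
  rintro rfl
  exact WTree.not_desc_of_ne_children hc h.mem_children hcl hd (WTree.Desc.refl T ℓ')

/-- The leaf under the parent of `ℓ` to which the robots at `ℓ` can be moved. -/
lemma exists_target (h : IsKill T ℓ T') {x : ℕ → ℕ} (hx : x ∈ discreteConfigs k T) :
    ∃ ℓ' ∈ T.leaves, ℓ' ≠ ℓ ∧ T.Desc ℓ' (T.parent ℓ) ∧
      (1 ≤ x ℓ' ∨ ∀ u ∈ T.anc ℓ' \ T.anc ℓ, T.mass (toFrac x) u = 0) := by
  -- If the target is occupied, stability will bound its price; if no such leaf is occupied, the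
  -- masses on the way down vanish and its price is explicit.
  by_cases hex : ∃ ℓ' ∈ T.leaves, ℓ' ≠ ℓ ∧ T.Desc ℓ' (T.parent ℓ) ∧ 1 ≤ x ℓ'
  · obtain ⟨ℓ', h1, h2, h3, h4⟩ := hex
    exact ⟨ℓ', h1, h2, h3, Or.inl h4⟩
  · push Not at hex
    obtain ⟨ℓ', h1, h2, h3⟩ := h.exists_leaf
    refine ⟨ℓ', h1, h2, h3, Or.inr fun u hu => Finset.sum_eq_zero fun v hv => ?_⟩
    rw [Finset.mem_sdiff, WTree.mem_anc, WTree.mem_anc] at hu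
    obtain ⟨⟨hur, huV, hu1⟩, hu2⟩ := hu
    have hnd : ¬ T.Desc ℓ u := fun hd => hu2 ⟨hur, huV, hd⟩
    have hup : T.Desc u (T.parent ℓ) := (WTree.Desc.total h3 hu1).resolve_left
      fun hd => hnd ((WTree.Desc.parent T ℓ).trans hd)
    have hvu := (WTree.mem_descendants.1 hv).2
    have : x v = 0 := by
      by_cases hl : v ∈ T.leaves
      · have := hex v hl (fun he => hnd (he ▸ hvu)) (hvu.trans hup)
        omega
      · exact hx.1 v hl
    simp [toFrac, this]

end IsKill

/-- Strong convexity adds `48 * 5 = 240` times `d y²` at `ℓ` to the right side. The left side grows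
by at most the cost of sending all robots of `ℓ` to the target. The invariant `1 / 2 ≤ y ℓ` settles
the case of at most one robot, where `lower_bounds` does not apply. -/
lemma Invariant.kill {x x' : ℕ → ℕ} {c : ℝ} (hk : 2 ≤ k) (h : Invariant k T x c)
    (hstable : Stable (pot k) k T x) (hT : IsKill T ℓ T')
    (hresp : IsResponse (pot k) k T x T' x') :
    Invariant k T' x' (c + T.OT (toFrac x) (toFrac x')) := by
  refine ⟨hresp.1, fun y' hy' => ?_⟩
  obtain ⟨y, hy⟩ := exists_isOptimalFrac k T
  obtain ⟨h1, h2⟩ := h.2 y hy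
  refine ⟨fun v hv => (h1 v (hT.mem_leaves_iff.1 hv).1).trans (hT.le_of_other_leaf hy hy' hv), ?_⟩
  obtain ⟨hm, h0⟩ := hT.mem_fracConfigs_iff.1 hy'.1
  obtain ⟨ℓ', hℓ', hne, hd, hcase⟩ := hT.exists_target h.1
  have hA := hT.anc_sdiff hℓ' hne hd
  have hws := hstable.weaklyStable
  have hmem := transfer_mem_discreteConfigs h.1 hT.leaf hℓ' hne.symm le_rfl
  have hmem' := hT.mem_discreteConfigs hmem (by simp [transfer])
  have h3 : T'.Psi (pot k) (toFrac x') + T.OT (toFrac x) (toFrac x') ≤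
      T'.Psi (pot k) (toFrac (transfer x ℓ ℓ' (x ℓ))) +
        T.OT (toFrac x) (toFrac (transfer x ℓ ℓ' (x ℓ))) := hresp.2 hmem'
  rw [hT.Psi_eq (toFrac_mem_fracConfigs hmem').1, toFrac_transfer hne.symm le_rfl,
    WTree.Psi_shift k _ hT.leaf_mem (WTree.mem_V_of_mem_leaves hℓ'),
    WTree.OT_shift _ hT.leaf_mem (WTree.mem_V_of_mem_leaves hℓ') (Nat.cast_nonneg _), hA] at h3
  have hlen : T.len {ℓ} = T.d ℓ := by simp [WTree.len]
  have hd0 := T.d_pos ℓ hT.leaf_mem hT.ne_root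
  have h4 := hy.add_sq_le hm hT.leaf_mem hT.ne_root
  rw [WTree.mass_leaf _ hT.leaf, WTree.mass_leaf _ hT.leaf, h0] at h4
  have hyl := h1 ℓ hT.leaf
  have hyk := le_of_mem_fracConfigs hy.1 ℓ
  have hkpos : (0 : ℝ) < k := by exact_mod_cast (by omega : 0 < k)
  have hprice : WTree.price k T y ℓ' ≤ WTree.price k T y ℓ :=
    hy.price_le hℓ' hT.leaf (by linarith [h1 ℓ' hℓ'])
  rw [← sub_nonneg, WTree.price_sub_price, hA, Finset.sum_singleton, WTree.mass_leaf _ hT.leaf]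
    at hprice
  have hB : 20 * k * T.len (T.anc ℓ' \ T.anc ℓ) ≤
      ∑ u ∈ T.anc ℓ' \ T.anc ℓ, T.d u * (20 * k + 10 * T.mass y u) := by
    rw [WTree.len, Finset.mul_sum]
    refine Finset.sum_le_sum fun u hu => ?_
    obtain ⟨h5, h6, -⟩ := WTree.mem_anc.1 (Finset.mem_sdiff.1 hu).1
    have h7 := T.d_pos u h6 h5
    have h8 := mul_nonneg h7.le (WTree.mass_nonneg (T := T) (fracConfigs_nonneg hy.1) u)
    nlinarith
  have hB0 := WTree.len_anc_sdiff_nonneg T ℓ' ℓ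
  have hΔ : WTree.price k T (toFrac x) ℓ' - WTree.price k T (toFrac x) ℓ ≤
      6 * (T.len (T.anc ℓ' \ T.anc ℓ) + T.d ℓ) ∨
      WTree.price k T (toFrac x) ℓ' - WTree.price k T (toFrac x) ℓ ≤
      10 * (T.d ℓ * y ℓ) - 10 * (T.d ℓ * x ℓ) := by
    rcases hcase with hx1 | hx0
    · left
      have := hws.price_sub_le h.1 hℓ' hT.leaf hne hx1
      rwa [hA, hlen] at this
    · right
      rw [WTree.price_sub_price, hA, Finset.sum_singleton, WTree.mass_leaf _ hT.leaf]
      have : ∑ u ∈ T.anc ℓ' \ T.anc ℓ, T.d u * (20 * k + 10 * T.mass (toFrac x) u) =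
          20 * k * T.len (T.anc ℓ' \ T.anc ℓ) := by
        rw [WTree.len, Finset.mul_sum]
        refine Finset.sum_congr rfl fun u hu => ?_
        rw [hx0 u hu]
        ring
      rw [this]
      simp only [toFrac]
      nlinarith
  rw [hlen] at h3
  set L := T.len (T.anc ℓ' \ T.anc ℓ)
  set P := WTree.price k T (toFrac x) ℓ' - WTree.price k T (toFrac x) ℓ
  -- Since `y` loads the target, its price is at most that of `ℓ`: the descent from the parent costs
  -- at least `20 k L`, the edge of `ℓ` at most `30 k d`.
  have hL : L ≤ 3 / 2 * T.d ℓ := by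
    have h5 : T.d ℓ * (20 * k + 10 * y ℓ) ≤ T.d ℓ * (30 * k) :=
      mul_le_mul_of_nonneg_left (by linarith) hd0.le
    have h6 : k * L ≤ k * (3 / 2 * T.d ℓ) := by linarith
    exact le_of_mul_le_mul_left h6 hkpos
  have hn0 : (0 : ℝ) ≤ x ℓ := Nat.cast_nonneg _
  have hsq : (5 * (x ℓ : ℝ) ^ 2 + x ℓ) * (T.d ℓ + L) ≤
      (5 * (x ℓ : ℝ) ^ 2 + x ℓ) * (5 / 2 * T.d ℓ) :=
    mul_le_mul_of_nonneg_left (by linarith) (by positivity)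
  have hbound : (x ℓ : ℝ) * P ≤ T.d ℓ * (15 * x ℓ) ∨
      (x ℓ : ℝ) * P ≤ T.d ℓ * (10 * x ℓ * y ℓ - 10 * (x ℓ : ℝ) ^ 2) := by
    rcases hΔ with hΔ | hΔ
    · left
      have := mul_le_mul_of_nonneg_left (hΔ.trans
        (by linarith : 6 * (L + T.d ℓ) ≤ 15 * T.d ℓ)) hn0
      linarith
    · right
      have := mul_le_mul_of_nonneg_left hΔ hn0
      linarith
  -- The factor `5 / 2` is `1 + 3 / 2`, from `d + L`. For `x ℓ ≤ 1` the bound `y ℓ ≥ 1 / 2`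
  -- suffices, otherwise `y ℓ ≥ 17 x / 50`.
  have hnum : 15 * (x ℓ : ℝ) + 5 / 2 * (5 * (x ℓ : ℝ) ^ 2 + x ℓ) ≤ 240 * y ℓ ^ 2 ∧
      10 * x ℓ * y ℓ - 10 * (x ℓ : ℝ) ^ 2 + 5 / 2 * (5 * (x ℓ : ℝ) ^ 2 + x ℓ) ≤
        240 * y ℓ ^ 2 := by
    rcases Nat.lt_or_ge (x ℓ) 2 with hx2 | hx2
    · have hx1 : (x ℓ : ℝ) ≤ 1 := by exact_mod_cast (by omega : x ℓ ≤ 1)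
      constructor <;> nlinarith
    · obtain ⟨-, h6⟩ := hws.lower_bounds hk h.1 hy hT.leaf hx2
      have hx2' : (2 : ℝ) ≤ x ℓ := by exact_mod_cast hx2
      have h7 : (17 / 50 * (x ℓ : ℝ)) ^ 2 ≤ y ℓ ^ 2 := by gcongr
      constructor <;> nlinarith
  have hfin : (x ℓ : ℝ) * P + (5 * (x ℓ : ℝ) ^ 2 + x ℓ) * (T.d ℓ + L) ≤
      T.d ℓ * (240 * y ℓ ^ 2) := by
    rcases hbound with hb | hb
    · have := mul_le_mul_of_nonneg_left hnum.1 hd0.le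
      linarith
    · have := mul_le_mul_of_nonneg_left hnum.2 hd0.le
      linarith
  rw [hT.Psi_eq hy'.1.1]
  linarith

end Kill

/-! ### Voluntary moves, the initial state, fork thresholds and the induction on plays -/

lemma Invariant.move {k : ℕ} {T : WTree} {x x' : ℕ → ℕ} {c : ℝ} (h : Invariant k T x c)
    (hresp : IsResponse (pot k) k T x T x') :
    Invariant k T x' (c + T.OT (toFrac x) (toFrac x')) := by
  refine ⟨hresp.1, fun y hy => ⟨(h.2 y hy).1, ?_⟩⟩
  have h1 : T.Psi (pot k) (toFrac x') + T.OT (toFrac x) (toFrac x') ≤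
      T.Psi (pot k) (toFrac x) + T.OT (toFrac x) (toFrac x) := hresp.2 h.1
  rw [OT_self] at h1
  linarith [(h.2 y hy).2]

/-- A tree with at most one edge has only one leaf. -/
lemma WTree.eq_of_mem_leaves {T : WTree} (hT : T.V.card ≤ 2) {ℓ ℓ' : ℕ} (hℓ : ℓ ∈ T.leaves)
    (hℓ' : ℓ' ∈ T.leaves) : ℓ = ℓ' := by
  by_contra hne
  have hV := mem_V_of_mem_leaves hℓ
  have hV' := mem_V_of_mem_leaves hℓ'
  have hr : T.root ∉ T.leaves := by
    intro hr
    exact hne ((eq_of_desc_leaf hV hr (desc_root hV)).trans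
      (eq_of_desc_leaf hV' hr (desc_root hV')).symm)
  have h1 : ({T.root, ℓ, ℓ'} : Finset ℕ) ⊆ T.V := by
    intro v hv
    simp only [Finset.mem_insert, Finset.mem_singleton] at hv
    rcases hv with rfl | rfl | rfl
    exacts [T.root_mem, hV, hV']
  have h2 : ({T.root, ℓ, ℓ'} : Finset ℕ).card = 3 :=
    Finset.card_eq_three.2 ⟨_, _, _, fun h : T.root = ℓ => hr (h ▸ hℓ),
      fun h : T.root = ℓ' => hr (h ▸ hℓ'), hne, rfl⟩
  have := Finset.card_le_card h1
  omega

/-- With a single leaf there is only one configuration, so `x` and `y` coincide. -/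
lemma Invariant.of_card_le_two {k : ℕ} {T : WTree} {x : ℕ → ℕ} (hk : 2 ≤ k) (hT : T.V.card ≤ 2)
    (hx : x ∈ discreteConfigs k T) : Invariant k T x 0 := by
  have key : ∀ {y}, y ∈ fracConfigs k T → ∀ ℓ ∈ T.leaves, y ℓ = k := by
    intro y hy ℓ hℓ
    rw [← hy.2.2, Finset.sum_eq_single_of_mem ℓ hℓ]
    exact fun v hv hne => absurd (WTree.eq_of_mem_leaves hT hv hℓ) hne
  have hk' : (2 : ℝ) ≤ k := by exact_mod_cast hk
  refine ⟨hx, fun y hy => ⟨fun ℓ hℓ => ?_, ?_⟩⟩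
  · rw [key hy.1 ℓ hℓ]
    linarith
  · have hxf := toFrac_mem_fracConfigs hx
    have : toFrac x = y := by
      funext v
      by_cases hv : v ∈ T.leaves
      · rw [key hy.1 v hv, key hxf v hv]
      · rw [hy.1.1 v hv, hxf.1 v hv]
    rw [this]
    have := Psi_nonneg (k := k) T (fracConfigs_nonneg hy.1)
    linarith

open scoped Classical in
/-- The threshold for the fork lengths. -/
def forkThreshold (k : ℕ) (T : WTree) (ℓ : ℕ) : ℝ :=
  -- The case distinction keeps the threshold positive for every argument, since `d` is arbitrary at
  -- the root and outside the tree.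
  if 0 < T.d ℓ then min (1 / 2) (T.d ℓ / (20 * k ^ 2)) else 1 / 2

lemma forkThreshold_pos {k : ℕ} (hk : 0 < k) (T : WTree) (ℓ : ℕ) : 0 < forkThreshold k T ℓ := by
  have : (0 : ℝ) < k := Nat.cast_pos.2 hk
  unfold forkThreshold
  split_ifs with h
  · positivity
  · norm_num

lemma forkThreshold_lt_one (k : ℕ) (T : WTree) (ℓ : ℕ) : forkThreshold k T ℓ < 1 := by
  unfold forkThreshold
  split_ifs with h
  · exact (min_le_left _ _).trans_lt (by norm_num)
  · norm_num

lemma forkThreshold_mul_le {k : ℕ} (hk : 0 < k) {T : WTree} {ℓ : ℕ} (hℓ : ℓ ∈ T.V)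
    (hr : ℓ ≠ T.root) : forkThreshold k T ℓ * (20 * k ^ 2) ≤ T.d ℓ := by
  have : (0 : ℝ) < k := Nat.cast_pos.2 hk
  rw [forkThreshold, if_pos (T.d_pos ℓ hℓ hr), ← le_div_iff₀ (by positivity)]
  exact min_le_right _ _

lemma Play.invariant {k : ℕ} (hk : 2 ≤ k) {δ : WTree → (ℕ → ℕ) → ℕ → ℕ → ℝ}
    (hδ : ∀ T x ℓ m, 0 < δ T x ℓ m ∧ δ T x ℓ m ≤ forkThreshold k T ℓ)
    {t : ℝ} {T : WTree} {x : ℕ → ℕ} {c : ℝ} (h : Play (pot k) k δ t T x c) :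
    Invariant k T x c := by
  induction h with
  | init T x hT hx => exact Invariant.of_card_le_two hk hT hx
  | elongate _ s hs lf hmeas hlf hstable ih =>
    exact ih.elongate_grown hk hs lf hmeas hlf hstable
  | move _ x' _ hresp ih => exact ih.move hresp
  | @fork t T x c _ hstable ℓ m hm hmx C hC T' hT' x' hresp ih =>
    refine ih.fork hstable hm hmx hC hT' (hδ T x ℓ m).1 (fun hr => ?_) hresp
    refine le_trans ?_ (forkThreshold_mul_le (zero_lt_two.trans_le hk) hT'.leaf_mem hr)
    exact mul_le_mul_of_nonneg_right (hδ T x ℓ m).2 (by positivity)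
  | kill _ hstable ℓ T' hT' x' hresp ih => exact ih.kill hk hstable hT' hresp

end

theorem mainTheorem5 (k : ℕ) (hk : 2 ≤ k) (a b : ℝ) (ha : a = 20 * k) (hb : b = 5)
    (φ : ℝ → ℝ) (hφ : ∀ z, φ z = a * z + b * z ^ 2) :
    ∃ δ₀ : WTree → (ℕ → ℕ) → ℕ → ℕ → ℝ,
      (∀ T x ℓ m, 0 < δ₀ T x ℓ m ∧ δ₀ T x ℓ m < 1) ∧
      ∀ δ : WTree → (ℕ → ℕ) → ℕ → ℕ → ℝ,
        (∀ T x ℓ m, 0 < δ T x ℓ m ∧ δ T x ℓ m ≤ δ₀ T x ℓ m) →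
        ∀ (t : ℝ) (T : WTree) (x : ℕ → ℕ) (cost : ℝ), Play φ k δ t T x cost →
          (∃! y, IsOptimalFrac φ k T y) ∧
          ∀ y, IsOptimalFrac φ k T y →
            cost + T.Psi φ (toFrac x) ≤ 48 * T.Psi φ y := by
  have hφ' : φ = pot k := by
    funext z
    rw [hφ, ha, hb, pot]
  subst hφ'
  refine ⟨fun T _ ℓ _ => forkThreshold k T ℓ,
    fun T _ ℓ _ => ⟨forkThreshold_pos (by omega) T ℓ, forkThreshold_lt_one k T ℓ⟩,
    fun δ hδ t T x cost hplay => ⟨?_, fun y hy => ((hplay.invariant hk hδ).2 y hy).2⟩⟩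
  obtain ⟨y, hy⟩ := exists_isOptimalFrac k T
  exact ⟨y, hy, fun z hz => hy.eq hz⟩
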